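/- Let $\mathbb{C}P^n$ carry the Fubini–Study symplectic form $\omega$, normalized so that the integral of $\omega$ over a projective line is $1$ (hence $\int_{\mathbb{C}P^n}\omega^n=1$). Let $G=\mathrm{Ham}(\mathbb{C}P^n,\omega)$ be the group of Hamiltonian diffeomorphisms, i.e. of the time-one maps $\phi_H$ of the Hamiltonian flows of smooth functions $H:[0,1]\times\mathbb{C}P^n\to\mathbb{R}$, $H_t=H(t,\cdot)$. The Hofer metric is $\rho(f,g)=\inf\int_0^1(\max H_t-\min H_t)\,dt$, the infimum being over all $H$ with $\phi_H=f^{-1}g$. A function $\mu:G\to\mathbb{R}$ is a quasimorphism if $|\mu(fg)-\mu(f)-\mu(g)|\le R$ for some $R>0$ and all $f,g\in G$; it is homogeneous if $\mu(g^m)=m\,\mu(g)$ for all $g\in G$, $m\in\mathbb{Z}$. A quasimorphism $\mu$ is a Calabi quasimorphism if, for every non-empty open set $U\subset\mathbb{C}P^n$ on which $\omega$ is exact and such that $h(U)\cap\overline{U}=\emptyset$ for some $h\in G$, one has $$\mu(\phi_H)=\int_0^1\Big(\int_{\mathbb{C}P^n}H_t\,\omega^n\Big)dt$$ for every smooth $H:[0,1]\times\mathbb{C}P^n\to\mathbb{R}$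 with $\operatorname{supp}H_t\subset U$ for all $t$. Let $$\Phi([z_0:\dots:z_n])=\Big(\frac{|z_1|^2}{|z_0|^2+\dots+|z_n|^2},\dots,\frac{|z_n|^2}{|z_0|^2+\dots+|z_n|^2}\Big),$$ whose image is the simplex $\Delta=\{p\in\mathbb{R}^n: p_i\ge 0,\ p_1+\dots+p_n\le 1\}$, with barycenter $p_{clif}=(\tfrac1{n+1},\dots,\tfrac1{n+1})$. A function on $\Delta$ is smooth if it extends to a smooth function on a neighborhood of $\Delta$ in $\mathbb{R}^n$. Theorem. Let $\mu:G\to\mathbb{R}$ be any homogeneous Calabi quasimorphism which is continuous with respect to the Hofer metric. Then for every smooth function $\bar F:\Delta\to\mathbb{R}$, the autonomous Hamiltonian $F=\Phi^*\bar F=\bar F\circ\Phi$ generates a time-one map $\phi_F\in G$, and $$\mu(\phi_F)=\int_{\mathbb{C}P^n}F\,\omega^n-\bar F(p_{clif}).$$ -/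

import Mathlib

open Set Topology
open scoped Manifold ContDiff LinearAlgebra.Projectivization

noncomputable section

namespace CliffordCalabi

/-- Complex projective space `ℂPⁿ`, the space of complex lines in `ℂⁿ⁺¹`. -/
abbrev CP (n : ℕ) : Type := ℙ ℂ (Fin (n + 1) → ℂ)

/-- The model space `ℂⁿ`, regarded below as a real normed space. -/
abbrev Cn (n : ℕ) : Type := Fin n → ℂ

/-- The quotient topology, from `ℂⁿ⁺¹ ∖ {0}`. -/
instance instTopologicalSpaceCP (n : ℕ) : TopologicalSpace (CP n) :=
  TopologicalSpace.coinduced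
    (fun v : {v : Fin (n + 1) → ℂ // v ≠ 0} => Projectivization.mk ℂ v.1 v.2) inferInstance

/-- The domain `{z_j ≠ 0}` of the `j`-th affine chart. -/
def chartDomain {n : ℕ} (j : Fin (n + 1)) : Set (CP n) := {p | p.rep j ≠ 0}

/-- The `j`-th affine coordinates `(z_k / z_j)_{k ≠ j}`. -/
def affineCoord {n : ℕ} (j : Fin (n + 1)) (p : CP n) : Cn n :=
  fun k => p.rep (j.succAbove k) / p.rep j

/-- The vector of `ℂⁿ⁺¹` obtained from `w` by inserting a `1` at position `j`. -/
def affineVec {n : ℕ} (j : Fin (n + 1)) (w : Cn n) : Fin (n + 1) → ℂ :=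
  Fin.insertNth (α := fun _ => ℂ) j 1 w

theorem affineVec_self {n : ℕ} (j : Fin (n + 1)) (w : Cn n) : affineVec j w j = 1 := by
  simp [affineVec]

theorem affineVec_succAbove {n : ℕ} (j : Fin (n + 1)) (w : Cn n) (k : Fin n) :
    affineVec j w (j.succAbove k) = w k := by
  simp [affineVec]

theorem affineVec_ne_zero {n : ℕ} (j : Fin (n + 1)) (w : Cn n) : affineVec j w ≠ 0 := by
  intro h
  have := congrFun h j
  rw [affineVec_self] at this
  exact one_ne_zero this

/-- The point of `ℂPⁿ` with `j`-th affine coordinates `w`. -/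
def affinePoint {n : ℕ} (j : Fin (n + 1)) (w : Cn n) : CP n :=
  Projectivization.mk ℂ (affineVec j w) (affineVec_ne_zero j w)

theorem exists_rep_mk {n : ℕ} (v : Fin (n + 1) → ℂ) (hv : v ≠ 0) :
    ∃ c : ℂ, c ≠ 0 ∧ (Projectivization.mk ℂ v hv).rep = c • v := by
  obtain ⟨a, ha⟩ := Projectivization.exists_smul_eq_mk_rep ℂ v hv
  exact ⟨a, a.ne_zero, ha.symm⟩

theorem mk_mem_chartDomain {n : ℕ} (j : Fin (n + 1)) (v : Fin (n + 1) → ℂ) (hv : v ≠ 0) :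
    Projectivization.mk ℂ v hv ∈ chartDomain j ↔ v j ≠ 0 := by
  obtain ⟨c, hc, h⟩ := exists_rep_mk v hv
  simp [chartDomain, h, hc]

theorem affineCoord_mk {n : ℕ} (j : Fin (n + 1)) (v : Fin (n + 1) → ℂ) (hv : v ≠ 0) :
    affineCoord j (Projectivization.mk ℂ v hv) = fun k => v (j.succAbove k) / v j := by
  obtain ⟨c, hc, h⟩ := exists_rep_mk v hv
  ext k
  simp [affineCoord, h, mul_div_mul_left _ _ hc]

theorem affinePoint_mem {n : ℕ} (j : Fin (n + 1)) (w : Cn n) : affinePoint j w ∈ chartDomain j := by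
  rw [affinePoint, mk_mem_chartDomain, affineVec_self]
  exact one_ne_zero

theorem affineCoord_affinePoint {n : ℕ} (j : Fin (n + 1)) (w : Cn n) :
    affineCoord j (affinePoint j w) = w := by
  rw [affinePoint, affineCoord_mk]
  ext k
  rw [affineVec_self, affineVec_succAbove, div_one]

theorem affinePoint_affineCoord {n : ℕ} (j : Fin (n + 1)) (p : CP n) (hp : p ∈ chartDomain j) :
    affinePoint j (affineCoord j p) = p := by
  have hp' : p.rep j ≠ 0 := hp
  conv_rhs => rw [← p.mk_rep]
  rw [affinePoint, Projectivization.mk_eq_mk_iff']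
  refine ⟨(p.rep j)⁻¹, ?_⟩
  ext k
  rcases Fin.eq_self_or_eq_succAbove j k with rfl | ⟨l, rfl⟩
  · rw [affineVec_self]; simp [hp']
  · rw [affineVec_succAbove]; simp [affineCoord, div_eq_inv_mul]

theorem isQuotientMap_mk (n : ℕ) : IsQuotientMap
    (fun v : {v : Fin (n + 1) → ℂ // v ≠ 0} => Projectivization.mk ℂ v.1 v.2) :=
  ⟨⟨rfl⟩, fun p => ⟨⟨p.rep, p.rep_nonzero⟩, p.mk_rep⟩⟩

theorem isOpen_chartDomain {n : ℕ} (j : Fin (n + 1)) : IsOpen (chartDomain (n := n) j) := by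
  rw [← (isQuotientMap_mk n).isOpen_preimage]
  have : (fun v : {v : Fin (n + 1) → ℂ // v ≠ 0} => Projectivization.mk ℂ v.1 v.2) ⁻¹'
      chartDomain j = {v | v.1 j ≠ 0} := by
    ext v
    exact mk_mem_chartDomain j v.1 v.2
  rw [this]
  exact isOpen_ne_fun ((continuous_apply j).comp continuous_subtype_val) continuous_const

theorem continuous_affineVec {n : ℕ} (j : Fin (n + 1)) : Continuous (affineVec (n := n) j) := by
  refine continuous_pi fun k => ?_
  rcases Fin.eq_self_or_eq_succAbove j k with rfl | ⟨l, rfl⟩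
  · simp only [affineVec_self]; fun_prop
  · simp only [affineVec_succAbove]; fun_prop

theorem continuous_affinePoint {n : ℕ} (j : Fin (n + 1)) : Continuous (affinePoint (n := n) j) :=
  (isQuotientMap_mk n).continuous.comp
    ((continuous_affineVec j).subtype_mk (affineVec_ne_zero j))

theorem continuousOn_affineCoord {n : ℕ} (j : Fin (n + 1)) :
    ContinuousOn (affineCoord (n := n) j) (chartDomain j) := by
  rw [(isQuotientMap_mk n).continuousOn_isOpen_iff (isOpen_chartDomain j)]
  have : (affineCoord j ∘ fun v : {v : Fin (n + 1) → ℂ // v ≠ 0} =>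
      Projectivization.mk ℂ v.1 v.2) = fun v k => v.1 (j.succAbove k) / v.1 j := by
    funext v
    exact affineCoord_mk j v.1 v.2
  rw [this]
  refine continuousOn_pi.2 fun k => ContinuousOn.div
    ((continuous_apply _).comp continuous_subtype_val).continuousOn
    ((continuous_apply _).comp continuous_subtype_val).continuousOn ?_
  intro v hv
  exact (mk_mem_chartDomain j v.1 v.2).1 hv

/-- The `j`-th affine chart of `ℂPⁿ`. -/
def affineChart {n : ℕ} (j : Fin (n + 1)) : OpenPartialHomeomorph (CP n) (Cn n) where
  toFun := affineCoord j
  invFun := affinePoint j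
  source := chartDomain j
  target := univ
  map_source' _ _ := mem_univ _
  map_target' w _ := affinePoint_mem j w
  left_inv' p hp := affinePoint_affineCoord j p hp
  right_inv' w _ := affineCoord_affinePoint j w
  open_source := isOpen_chartDomain j
  open_target := isOpen_univ
  continuousOn_toFun := continuousOn_affineCoord j
  continuousOn_invFun := (continuous_affinePoint j).continuousOn

theorem exists_mem_chartDomain {n : ℕ} (p : CP n) : ∃ j, p ∈ chartDomain j := by
  by_contra! h
  exact p.rep_nonzero (funext fun j => not_not.1 (h j))

/-- The atlas of the `n + 1` affine charts. -/
instance instChartedSpaceCP (n : ℕ) : ChartedSpace (Cn n) (CP n) where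
  atlas := range affineChart
  chartAt p := affineChart (exists_mem_chartDomain p).choose
  mem_chart_source p := (exists_mem_chartDomain p).choose_spec
  chart_mem_atlas _ := mem_range_self _

/-- `ℂPⁿ` is a smooth (real) manifold. -/
instance instIsManifoldCP (n : ℕ) : IsManifold 𝓘(ℝ, Cn n) ∞ (CP n) := by
  apply isManifold_of_contDiffOn
  rintro _ _ ⟨i, rfl⟩ ⟨j, rfl⟩
  have hV : ContDiff ℝ ∞ (affineVec (n := n) i) := by
    refine contDiff_pi.2 fun k => ?_
    rcases Fin.eq_self_or_eq_succAbove i k with rfl | ⟨l, rfl⟩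
    · simp only [affineVec_self]; exact contDiff_const
    · simp only [affineVec_succAbove]; fun_prop
  have key : ContDiffOn ℝ ∞
      (fun (w : Cn n) (k : Fin n) => affineVec i w (j.succAbove k) / affineVec i w j)
      {w | affineVec i w j ≠ 0} := by
    refine contDiffOn_pi.2 fun k => ?_
    simp only [div_eq_mul_inv]
    refine ContDiffOn.mul ?_ (ContDiffOn.inv ?_ fun w hw => hw)
    · exact ((contDiff_pi.1 hV) _).contDiffOn
    · exact ((contDiff_pi.1 hV) _).contDiffOn
  refine (key.congr ?_).mono ?_
  · intro w _
    exact affineCoord_mk j _ _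
  · rintro w ⟨hw, -⟩
    have : affinePoint i w ∈ chartDomain j := hw.2
    exact (mk_mem_chartDomain j _ _).1 this

/-! ### The Fubini–Study form -/

/-- The Fubini–Study form `(i / 2π) ∂∂̄ log (1 + |w|²)` in an affine chart, at the point `w`,
evaluated on the tangent vectors `u` and `v`. Its integral over a projective line is `1`. -/
def fubiniStudyAffine {n : ℕ} (w u v : Cn n) : ℝ :=
  ((1 + ∑ k, ‖w k‖ ^ 2) * (∑ k, star (u k) * v k).im
    - ((∑ k, star (u k) * w k) * (∑ k, star (w k) * v k)).im)
    / (Real.pi * (1 + ∑ k, ‖w k‖ ^ 2) ^ 2)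

/-- The Fubini–Study symplectic form `ω` on `ℂPⁿ`. Mathlib represents tangent vectors at `p` by
their coordinates in the chart `chartAt p`, which is one of the affine charts. -/
def fubiniStudy {n : ℕ} (p : CP n) (u v : TangentSpace 𝓘(ℝ, Cn n) p) : ℝ :=
  fubiniStudyAffine (chartAt (Cn n) p p) (show Cn n from u) (show Cn n from v)

/-- The standard real basis of `ℂⁿ`. -/
def realBasisVec {n : ℕ} : Fin n ⊕ Fin n → Cn n :=
  Sum.elim (fun k => Pi.single k 1) (fun k => Pi.single k Complex.I)

/-- The density of the volume form `ωⁿ = ω ∧ ⋯ ∧ ω` with respect to Lebesgue measure in an affine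
chart: `n!` times the Pfaffian, i.e. the positive square root of the determinant, of the matrix
of `ω`. -/
def volumeDensity {n : ℕ} (w : Cn n) : ℝ :=
  n.factorial * √(Matrix.of fun a b : Fin n ⊕ Fin n =>
    fubiniStudyAffine w (realBasisVec a) (realBasisVec b)).det

/-- The integral `∫_{ℂPⁿ} F ωⁿ`, computed in the affine chart `w ↦ [1 : w₁ : … : wₙ]`, whose
complement is a hyperplane and so has measure zero. -/
def integralVolume {n : ℕ} (F : CP n → ℝ) : ℝ :=
  ∫ w : Cn n, F (affinePoint 0 w) * volumeDensity w

/-- The pullback of a `1`-form on `ℂPⁿ` to `ℂⁿ` under the `j`-th affine parametrization. -/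
def pullbackAffine {n : ℕ} (lam : (p : CP n) → TangentSpace 𝓘(ℝ, Cn n) p →L[ℝ] ℝ)
    (j : Fin (n + 1)) (w : Cn n) : Cn n →L[ℝ] ℝ :=
  (lam (affinePoint j w)).comp (mfderiv 𝓘(ℝ, Cn n) 𝓘(ℝ, Cn n) (affinePoint j) w)

/-- `ω` is exact on the open set `U`: there is a smooth `1`-form `λ` on `U` with `dλ = ω`.
Smoothness and the equation `dλ(u, v) = D_uλ(v) - D_vλ(u)` are read in the affine charts. -/
def ExactOn {n : ℕ} (U : Set (CP n)) : Prop :=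
  ∃ lam : (p : CP n) → TangentSpace 𝓘(ℝ, Cn n) p →L[ℝ] ℝ, ∀ j : Fin (n + 1),
    ContDiffOn ℝ ∞ (pullbackAffine lam j) (affinePoint j ⁻¹' U) ∧
    ∀ w ∈ affinePoint j ⁻¹' U, ∀ u v : Cn n,
      fderiv ℝ (pullbackAffine lam j) w u v - fderiv ℝ (pullbackAffine lam j) w v u
        = fubiniStudyAffine w u v

/-! ### Hamiltonian diffeomorphisms -/

/-- `X` is the value at `p` of the Hamiltonian vector field of `H`: `ω(X, ·) = -dH`. -/
def IsHamiltonianVector {n : ℕ} (H : CP n → ℝ) (p : CP n) (X : TangentSpace 𝓘(ℝ, Cn n) p) :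
    Prop :=
  ∀ v : TangentSpace 𝓘(ℝ, Cn n) p, fubiniStudy p X v = -(mfderiv 𝓘(ℝ, Cn n) 𝓘(ℝ, ℝ) H p v)

/-- `H` is a smooth (time-dependent) Hamiltonian `[0, 1] × ℂPⁿ → ℝ`. -/
def IsSmoothHamiltonian {n : ℕ} (H : ℝ → CP n → ℝ) : Prop :=
  ContMDiffOn (𝓘(ℝ, ℝ).prod 𝓘(ℝ, Cn n)) 𝓘(ℝ, ℝ) ∞ (fun q : ℝ × CP n => H q.1 q.2)
    (Icc 0 1 ×ˢ univ)

/-- `φ t`, `t ∈ [0, 1]`, is the Hamiltonian flow of `H`: `φ 0 = id` and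
`d/dt φ t x = X_{H t} (φ t x)`. -/
structure IsHamiltonianFlow {n : ℕ} (H : ℝ → CP n → ℝ) (φ : ℝ → CP n → CP n) : Prop where
  init : ∀ x, φ 0 x = x
  hasDeriv : ∀ x, ∀ t ∈ Icc (0 : ℝ) 1, ∃ X : TangentSpace 𝓘(ℝ, Cn n) (φ t x),
    IsHamiltonianVector (H t) (φ t x) X ∧
    HasMFDerivWithinAt 𝓘(ℝ, ℝ) 𝓘(ℝ, Cn n) (fun s => φ s x) (Icc 0 1) t
      ((1 : ℝ →L[ℝ] ℝ).smulRight X)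

/-- `g` is the time-one map `φ_H` of the flow of the smooth Hamiltonian `H`. -/
def IsTimeOneMap {n : ℕ} (H : ℝ → CP n → ℝ) (g : Equiv.Perm (CP n)) : Prop :=
  IsSmoothHamiltonian H ∧ ∃ φ : ℝ → CP n → CP n, IsHamiltonianFlow H φ ∧ ∀ x, φ 1 x = g x

theorem IsSmoothHamiltonian.mdifferentiableAt {n : ℕ} {H : ℝ → CP n → ℝ}
    (hH : IsSmoothHamiltonian H) {t : ℝ} (ht : t ∈ Icc (0 : ℝ) 1) (p : CP n) :
    MDifferentiableAt 𝓘(ℝ, Cn n) 𝓘(ℝ, ℝ) (H t) p := by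
  have h1 : ContMDiff 𝓘(ℝ, Cn n) (𝓘(ℝ, ℝ).prod 𝓘(ℝ, Cn n)) ∞ (fun q : CP n => (t, q)) :=
    contMDiff_const.prodMk contMDiff_id
  have h2 : ContMDiff 𝓘(ℝ, Cn n) 𝓘(ℝ, ℝ) ∞ (H t) := by
    rw [← contMDiffOn_univ]
    exact hH.comp h1.contMDiffOn fun q _ => ⟨ht, mem_univ _⟩
  exact (h2 p).mdifferentiableAt (by simp)

theorem fubiniStudy_smul_left {n : ℕ} (p : CP n) (c : ℝ) (u v : TangentSpace 𝓘(ℝ, Cn n) p) :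
    fubiniStudy p (c • u) v = c * fubiniStudy p u v := by
  have h : ∀ (w u v : Cn n), fubiniStudyAffine w (c • u) v = c * fubiniStudyAffine w u v := by
    intro w u v
    have e : ∀ x : Cn n, ∑ k, star ((c • u) k) * x k = (c : ℂ) * ∑ k, star (u k) * x k := by
      intro x
      rw [Finset.mul_sum]
      refine Finset.sum_congr rfl fun k _ => ?_
      simp [mul_assoc]
    simp only [fubiniStudyAffine, e, mul_assoc, Complex.im_ofReal_mul]
    ring
  exact h _ _ _

theorem IsHamiltonianVector.smul {n : ℕ} {H : CP n → ℝ} {p : CP n}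
    {X : TangentSpace 𝓘(ℝ, Cn n) p} (hX : IsHamiltonianVector H p X)
    (hH : MDifferentiableAt 𝓘(ℝ, Cn n) 𝓘(ℝ, ℝ) H p) (c : ℝ) :
    IsHamiltonianVector (fun x => c * H x) p (c • X) := by
  intro v
  have e : mfderiv 𝓘(ℝ, Cn n) 𝓘(ℝ, ℝ) (fun x => c * H x) p
      = c • mfderiv 𝓘(ℝ, Cn n) 𝓘(ℝ, ℝ) H p := const_smul_mfderiv hH c
  rw [fubiniStudy_smul_left, hX v, e]
  exact mul_neg c _

/-- Reparametrizing an integral curve in time by `a`. -/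
theorem IsHamiltonianFlow.reparam {n : ℕ} {H : ℝ → CP n → ℝ} {φ : ℝ → CP n → CP n}
    (hH : IsSmoothHamiltonian H) (hφ : IsHamiltonianFlow H φ) {a : ℝ → ℝ}
    (ha : ∀ t ∈ Icc (0 : ℝ) 1, a t ∈ Icc (0 : ℝ) 1) {t a' : ℝ} (ht : t ∈ Icc (0 : ℝ) 1)
    (hd : HasDerivAt a a' t) (x : CP n) :
    ∃ X : TangentSpace 𝓘(ℝ, Cn n) (φ (a t) x),
      IsHamiltonianVector (fun y => a' * H (a t) y) (φ (a t) x) X ∧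
      HasMFDerivWithinAt 𝓘(ℝ, ℝ) 𝓘(ℝ, Cn n) (fun s => φ (a s) x) (Icc 0 1) t
        ((1 : ℝ →L[ℝ] ℝ).smulRight X) := by
  obtain ⟨X, hX, hX'⟩ := hφ.hasDeriv x (a t) (ha t ht)
  refine ⟨a' • X, hX.smul (hH.mdifferentiableAt (ha t ht) _) a', ?_⟩
  have h1 : HasMFDerivWithinAt 𝓘(ℝ, ℝ) 𝓘(ℝ, ℝ) a (Icc 0 1) t
      ((1 : ℝ →L[ℝ] ℝ).smulRight a') :=
    hd.hasFDerivAt.hasFDerivWithinAt.hasMFDerivWithinAt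
  have h2 := HasMFDerivWithinAt.comp t hX' h1 (fun s hs => ha s hs)
  have e : (((1 : ℝ →L[ℝ] ℝ).smulRight X : ℝ →L[ℝ] Cn n)).comp ((1 : ℝ →L[ℝ] ℝ).smulRight a')
      = ((1 : ℝ →L[ℝ] ℝ).smulRight (a' • X : Cn n) : ℝ →L[ℝ] Cn n) := by
    ext k
    change (((1 : ℝ) • a') • (X : Cn n)) k = ((1 : ℝ) • (a' • (X : Cn n))) k
    rw [one_smul, one_smul]
  exact e ▸ h2

theorem IsSmoothHamiltonian.reparam {n : ℕ} {H : ℝ → CP n → ℝ} (hH : IsSmoothHamiltonian H)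
    {a : ℝ → ℝ} (ha : ∀ t ∈ Icc (0 : ℝ) 1, a t ∈ Icc (0 : ℝ) 1) (hs : ContDiff ℝ ∞ a) :
    IsSmoothHamiltonian (fun t y => deriv a t * H (a t) y) := by
  have hd : ContDiff ℝ ∞ (deriv a) := (contDiff_infty_iff_deriv.1 hs).2
  have h1 : ContMDiff (𝓘(ℝ, ℝ).prod 𝓘(ℝ, Cn n)) 𝓘(ℝ, ℝ) ∞
      (fun q : ℝ × CP n => deriv a q.1) := hd.contMDiff.comp contMDiff_fst
  have h2 : ContMDiff (𝓘(ℝ, ℝ).prod 𝓘(ℝ, Cn n)) (𝓘(ℝ, ℝ).prod 𝓘(ℝ, Cn n)) ∞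
      (fun q : ℝ × CP n => (a q.1, q.2)) :=
    (hs.contMDiff.comp contMDiff_fst).prodMk contMDiff_snd
  have h3 := ContMDiffOn.comp hH h2.contMDiffOn
    (s := Icc (0 : ℝ) 1 ×ˢ (univ : Set (CP n))) fun q hq => ⟨ha _ hq.1, mem_univ _⟩
  exact h1.contMDiffOn.smul h3

theorem isTimeOneMap_one (n : ℕ) : IsTimeOneMap (n := n) (fun _ _ => 0) 1 := by
  refine ⟨contMDiffOn_const, fun _ x => x, ⟨fun _ => rfl, fun x t _ => ⟨0, ?_, ?_⟩⟩, fun _ => rfl⟩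
  · intro v
    have h := fubiniStudy_smul_left x 0 0 v
    rw [zero_smul, zero_mul] at h
    have h0 : mfderiv 𝓘(ℝ, Cn n) 𝓘(ℝ, ℝ) (fun _ : CP n => (0 : ℝ)) x = 0 := mfderiv_const
    rw [h, h0]
    exact neg_zero.symm
  · have e : ((1 : ℝ →L[ℝ] ℝ).smulRight (0 : Cn n)) = 0 := by ext; simp
    exact e ▸ hasMFDerivWithinAt_const _ _ _

theorem IsTimeOneMap.exists_inv {n : ℕ} {H : ℝ → CP n → ℝ} {g : Equiv.Perm (CP n)}
    (h : IsTimeOneMap H g) : ∃ K, IsTimeOneMap K g⁻¹ := by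
  obtain ⟨hH, φ, hφ, hg⟩ := h
  have ha : ∀ t ∈ Icc (0 : ℝ) 1, 1 - t ∈ Icc (0 : ℝ) 1 :=
    fun t ht => ⟨by linarith [ht.2], by linarith [ht.1]⟩
  refine ⟨_, hH.reparam ha (by fun_prop), fun t x => φ (1 - t) (g⁻¹ x), ⟨fun x => ?_, ?_⟩,
    fun x => ?_⟩
  · simp [hg]
  · intro x t ht
    exact hφ.reparam hH ha ht (DifferentiableAt.hasDerivAt (by fun_prop)) (g⁻¹ x)
  · simp [hφ.init]

theorem IsTimeOneMap.exists_mul {n : ℕ} {H K : ℝ → CP n → ℝ} {f g : Equiv.Perm (CP n)}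
    (hf : IsTimeOneMap H f) (hg : IsTimeOneMap K g) : ∃ L, IsTimeOneMap L (f * g) := by
  obtain ⟨hH, φ, hφ, hf⟩ := hf
  obtain ⟨hK, ψ, hψ, hg⟩ := hg
  let a : ℝ → ℝ := fun t => Real.smoothTransition (3 * t)
  let b : ℝ → ℝ := fun t => Real.smoothTransition (3 * t - 2)
  have ha : ∀ t ∈ Icc (0 : ℝ) 1, a t ∈ Icc (0 : ℝ) 1 :=
    fun t _ => ⟨Real.smoothTransition.nonneg _, Real.smoothTransition.le_one _⟩
  have hb : ∀ t ∈ Icc (0 : ℝ) 1, b t ∈ Icc (0 : ℝ) 1 :=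
    fun t _ => ⟨Real.smoothTransition.nonneg _, Real.smoothTransition.le_one _⟩
  have has : ContDiff ℝ ∞ a := Real.smoothTransition.contDiff.comp (by fun_prop)
  have hbs : ContDiff ℝ ∞ b := Real.smoothTransition.contDiff.comp (by fun_prop)
  have hda : ∀ t, HasDerivAt a (deriv a t) t := fun t =>
    (has.differentiable (by simp) t).hasDerivAt
  have hdb : ∀ t, HasDerivAt b (deriv b t) t := fun t =>
    (hbs.differentiable (by simp) t).hasDerivAt
  have ha1 : ∀ t, 1 / 3 < t → a t = 1 := fun t ht =>
    Real.smoothTransition.one_of_one_le (by linarith)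
  have hb0 : ∀ t, t < 2 / 3 → b t = 0 := fun t ht =>
    Real.smoothTransition.zero_of_nonpos (by linarith)
  refine ⟨fun t y => deriv a t * K (a t) y + deriv b t * H (b t) y,
    (hK.reparam ha has).add (hH.reparam hb hbs), fun t x => φ (b t) (ψ (a t) x),
    ⟨fun x => ?_, ?_⟩, fun x => ?_⟩
  · have h1 : a 0 = 0 := Real.smoothTransition.zero_of_nonpos (by norm_num)
    simp only [hb0 0 (by norm_num), h1, hφ.init, hψ.init]
  · intro x t ht
    rcases lt_or_ge t (1 / 2) with h | h
    · have ev : ∀ᶠ s in 𝓝 t, b s = 0 := by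
        filter_upwards [Iio_mem_nhds h] with s hs
        exact hb0 s (lt_trans hs (by norm_num))
      have hd0 : deriv b t = 0 := by
        rw [Filter.EventuallyEq.deriv_eq (f := fun _ => (0 : ℝ)) ev, deriv_const]
      obtain ⟨X, hX, hX'⟩ := hψ.reparam hK ha ht (hda t) x
      have e : φ (b t) (ψ (a t) x) = ψ (a t) x := by rw [ev.self_of_nhds, hφ.init]
      rw [e]
      refine ⟨X, by simpa [hd0] using hX, hX'.congr_of_eventuallyEq ?_ e⟩
      filter_upwards [mem_nhdsWithin_of_mem_nhds ev] with s hs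
      simp only [hs, hφ.init]
    · have ev : ∀ᶠ s in 𝓝 t, a s = 1 := by
        filter_upwards [Ioi_mem_nhds (show 1 / 3 < t by linarith)] with s hs
        exact ha1 s hs
      have hd0 : deriv a t = 0 := by
        rw [Filter.EventuallyEq.deriv_eq (f := fun _ => (1 : ℝ)) ev, deriv_const]
      obtain ⟨X, hX, hX'⟩ := hφ.reparam hH hb ht (hdb t) (ψ 1 x)
      have e : φ (b t) (ψ (a t) x) = φ (b t) (ψ 1 x) := by rw [ev.self_of_nhds]
      rw [e]
      refine ⟨X, by simpa [hd0] using hX, hX'.congr_of_eventuallyEq ?_ e⟩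
      filter_upwards [mem_nhdsWithin_of_mem_nhds ev] with s hs
      simp only [hs]
  · have h1 : b 1 = 1 := Real.smoothTransition.one_of_one_le (by norm_num)
    simp only [ha1 1 (by norm_num), h1, hf, hg]
    rfl

/-- The group `Ham(ℂPⁿ)` of Hamiltonian diffeomorphisms, i.e. of the time-one maps of smooth
Hamiltonians, under composition. -/
def Ham (n : ℕ) : Subgroup (Equiv.Perm (CP n)) where
  carrier := {g | ∃ H, IsTimeOneMap H g}
  one_mem' := ⟨_, isTimeOneMap_one n⟩
  mul_mem' := fun ⟨_, hf⟩ ⟨_, hg⟩ => hf.exists_mul hg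
  inv_mem' := fun ⟨_, h⟩ => h.exists_inv

/-- The Hofer norm of `g`: the infimum, over the Hamiltonians `H` generating `g`, of
`∫₀¹ (max H_t - min H_t) dt`. -/
def hoferNorm {n : ℕ} (g : Ham n) : ℝ :=
  sInf {l | ∃ H : ℝ → CP n → ℝ, IsTimeOneMap H g ∧
    l = ∫ t in (0 : ℝ)..1, ((⨆ x, H t x) - ⨅ x, H t x)}

/-- The Hofer distance. -/
def hoferDist {n : ℕ} (f g : Ham n) : ℝ := hoferNorm (f⁻¹ * g)

/-- Continuity with respect to the Hofer distance. -/
def HoferContinuous {n : ℕ} (μ : Ham n → ℝ) : Prop :=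
  ∀ f : Ham n, ∀ ε > 0, ∃ δ > 0, ∀ g : Ham n, hoferDist f g < δ → |μ g - μ f| < ε

/-! ### Calabi quasimorphisms -/

/-- `μ` satisfies the homomorphism equation up to a bounded error. -/
def IsQuasimorphism {G : Type*} [Group G] (μ : G → ℝ) : Prop :=
  ∃ R > 0, ∀ f g : G, |μ (f * g) - μ f - μ g| ≤ R

/-- `μ (gᵐ) = m μ(g)` for all integers `m`. -/
def IsHomogeneous {G : Type*} [Group G] (μ : G → ℝ) : Prop :=
  ∀ (g : G) (m : ℤ), μ (g ^ m) = m * μ g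

/-- `U` is displaced by a Hamiltonian diffeomorphism `h`: `h(U) ∩ closure U = ∅`. -/
def Displaceable {n : ℕ} (U : Set (CP n)) : Prop :=
  ∃ h : Ham n, (h : Equiv.Perm (CP n)) '' U ∩ closure U = ∅

/-- A Calabi quasimorphism: a quasimorphism on `Ham(ℂPⁿ)` such that, for every non-empty open
displaceable set `U` on which `ω` is exact, and every Hamiltonian `H` with `supp H_t ⊆ U` for all
`t`, one has `μ(φ_H) = ∫₀¹ (∫ H_t ωⁿ) dt`. -/
structure IsCalabiQuasimorphism {n : ℕ} (μ : Ham n → ℝ) : Prop where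
  quasimorphism : IsQuasimorphism μ
  calabi : ∀ U : Set (CP n), IsOpen U → U.Nonempty → Displaceable U → ExactOn U →
    ∀ (H : ℝ → CP n → ℝ) (g : Ham n), IsTimeOneMap H g →
      (∀ t ∈ Icc (0 : ℝ) 1, tsupport (H t) ⊆ U) →
      μ g = ∫ t in (0 : ℝ)..1, integralVolume (H t)

/-! ### The moment map -/

/-- The moment map `Φ([z]) = (|z_k|² / |z|²)_{k = 1, …, n}` of the torus action. -/
def momentMap {n : ℕ} (p : CP n) : Fin n → ℝ :=
  fun k => ‖p.rep k.succ‖ ^ 2 / ∑ i, ‖p.rep i‖ ^ 2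

/-- The moment simplex `Δ`. -/
def momentSimplex (n : ℕ) : Set (Fin n → ℝ) := {p | (∀ i, 0 ≤ p i) ∧ ∑ i, p i ≤ 1}

theorem momentMap_mem {n : ℕ} (p : CP n) : momentMap p ∈ momentSimplex n := by
  refine ⟨fun i => by unfold momentMap; positivity, ?_⟩
  simp only [momentMap]
  rw [← Finset.sum_div]
  refine div_le_one_of_le₀ ?_ (by positivity)
  rw [Fin.sum_univ_succ]
  linarith [sq_nonneg ‖p.rep 0‖]

/-- The barycenter of `Δ`. -/
def clifPoint (n : ℕ) : Fin n → ℝ := fun _ => 1 / (n + 1)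

theorem clifPoint_mem (n : ℕ) : clifPoint n ∈ momentSimplex n := by
  refine ⟨fun i => by unfold clifPoint; positivity, ?_⟩
  have h : (0 : ℝ) < n + 1 := by positivity
  simp only [clifPoint, Finset.sum_const, Finset.card_univ, Fintype.card_fin, nsmul_eq_mul]
  rw [mul_one_div, div_le_one h]
  linarith

/-- A function on `Δ` is smooth if it extends to a smooth function on a neighborhood of `Δ`. -/
def SmoothOnSimplex {n : ℕ} (Fbar : momentSimplex n → ℝ) : Prop :=
  ∃ V : Set (Fin n → ℝ), IsOpen V ∧ momentSimplex n ⊆ V ∧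
    ∃ G : (Fin n → ℝ) → ℝ, ContDiffOn ℝ ∞ G V ∧ ∀ p : momentSimplex n, G p = Fbar p

/-- The function `Φ^* F̄` on `ℂPⁿ`. -/
def momentPullback {n : ℕ} (Fbar : momentSimplex n → ℝ) (x : CP n) : ℝ :=
  Fbar ⟨momentMap x, momentMap_mem x⟩

end CliffordCalabi

end

open CliffordCalabi

/-!
Write `ζ(G) = μ(φ_G) - ∫ (G ∘ Φ) ωⁿ` for a smooth function `G` on `ℝⁿ`, where `φ_G` is the time-one
map of the Hamiltonian `G ∘ Φ` (`calabiDefect`). The claim is that `ζ(G) = -G(p_clif)`.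

The flow of `G ∘ Φ` is explicit: it fixes the homogeneous coordinate `z_0` and rotates `z_k`, for
`k ≥ 1`, with the constant angular velocity `2π ∂_k G(Φ(z))` (`isHamiltonianFlow_torusFlow`), and
its time-one map is unique, because `Φ` is constant along any solution and the flow equation is then
linear with constant coefficients in an affine chart (`IsHamiltonianFlow.eq_torusFlow`). Hence
`φ_{F + G} = φ_F φ_G` and all the `φ_G` commute. As a homogeneous quasimorphism is additive on
commuting elements, `ζ` is additive; as `μ` is Hofer continuous, `ζ(G)` is small when `G` is
uniformly small on `Δ`. Moreover `ζ(c) = -c` for constants `c`, because `φ_c = 1` and `∫ ωⁿ = 1`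
(`integral_volumeDensity`).

For `i ≠ j` the transposition of `z_i` and `z_j` is Hamiltonian, being the time-one map of a
one-parameter group of unitary maps, and it displaces the open set `{|z_j| < |z_i|}`
(`displaceable_dominated`). On that set `z_i ≠ 0`, so `ω` has the primitive
`d^c log(|z|² / |z_i|²) / 4π` (`exactOn_chartDomain`). The Calabi property therefore gives
`ζ(G) = 0` whenever `G ∘ Φ` is supported in one of these sets (`calabiDefect_eq_zero`). Together
they cover the complement of the Clifford torus `Φ = p_clif`: multiplying `G` by suitable cutoff
functions leaves `ζ(G)` unchanged and confines `G` to an arbitrarily small neighbourhood of the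
barycenter (`calabiDefect_mul_coreCutoff`). If `G(p_clif) = 0`, the result is uniformly small, so
`ζ(G) = 0`. Subtracting the constant `G(p_clif)` settles the general case.

Computations on `ℂPⁿ` are done in homogeneous coordinates: `liftForm` is the pullback of `ω` to
`ℂⁿ⁺¹ ∖ {0}`, and the Hamilton equation may be checked on lifts (`IsLift.isHamiltonianVector`).
-/

noncomputable section

namespace CliffordCalabi

/-! ### The Fubini–Study form in homogeneous coordinates -/

/-- The standard Hermitian form, antilinear in the first variable. -/
def herm {ι : Type*} [Fintype ι] (a b : ι → ℂ) : ℂ := ∑ k, star (a k) * b k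

/-- The squared Euclidean norm of a complex vector. -/
def normSqSum {ι : Type*} [Fintype ι] (z : ι → ℂ) : ℝ := ∑ k, ‖z k‖ ^ 2

section herm

variable {ι : Type*} [Fintype ι]

theorem herm_add_left (a b c : ι → ℂ) : herm (a + b) c = herm a c + herm b c := by
  simp [herm, add_mul, Finset.sum_add_distrib]

theorem herm_add_right (a b c : ι → ℂ) : herm a (b + c) = herm a b + herm a c := by
  simp [herm, mul_add, Finset.sum_add_distrib]

theorem herm_smul_left (r : ℂ) (a b : ι → ℂ) : herm (r • a) b = star r * herm a b := by
  simp [herm, Finset.mul_sum, mul_assoc]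

theorem herm_smul_right (r : ℂ) (a b : ι → ℂ) : herm a (r • b) = r * herm a b := by
  simp only [herm, Finset.mul_sum, Pi.smul_apply, smul_eq_mul]
  exact Finset.sum_congr rfl fun k _ => by ring

theorem star_herm (a b : ι → ℂ) : star (herm a b) = herm b a := by
  simp [herm, mul_comm]

theorem herm_self (z : ι → ℂ) : herm z z = (normSqSum z : ℂ) := by
  simp only [herm, normSqSum, Complex.ofReal_sum]
  refine Finset.sum_congr rfl fun k _ => ?_
  rw [Complex.star_def, Complex.conj_mul']
  push_cast
  rfl

theorem normSqSum_nonneg (z : ι → ℂ) : 0 ≤ normSqSum z :=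
  Finset.sum_nonneg fun _ _ => by positivity

theorem normSqSum_pos {z : ι → ℂ} (hz : z ≠ 0) : 0 < normSqSum z := by
  obtain ⟨k, hk⟩ := Function.ne_iff.1 hz
  exact Finset.sum_pos' (fun _ _ => by positivity)
    ⟨k, Finset.mem_univ _, by have := norm_pos_iff.2 hk; positivity⟩

theorem normSqSum_smul (c : ℂ) (z : ι → ℂ) : normSqSum (c • z) = ‖c‖ ^ 2 * normSqSum z := by
  simp [normSqSum, Finset.mul_sum, mul_pow]

theorem contDiff_normSqSum : ContDiff ℝ ∞ (normSqSum : (ι → ℂ) → ℝ) :=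
  ContDiff.sum fun k _ => (contDiff_apply ℝ ℂ k).norm_sq ℝ

theorem continuous_normSqSum : Continuous (normSqSum : (ι → ℂ) → ℝ) :=
  contDiff_normSqSum.continuous

theorem hasFDerivAt_normSq_apply (k : ι) (z : ι → ℂ) :
    HasFDerivAt (fun z : ι → ℂ => ‖z k‖ ^ 2)
      ((2 : ℝ) • Complex.reCLM.comp ((star (z k)) • ContinuousLinearMap.proj (R := ℝ) k)) z := by
  have h := (ContinuousLinearMap.proj (R := ℝ) (φ := fun _ : ι => ℂ) k).hasFDerivAt (x := z)
  refine h.norm_sq.congr_fderiv ?_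
  ext b
  simp [Complex.inner]
  ring

theorem hasFDerivAt_normSqSum (z : ι → ℂ) :
    HasFDerivAt (normSqSum : (ι → ℂ) → ℝ)
      (∑ k, (2 : ℝ) • Complex.reCLM.comp ((star (z k)) • ContinuousLinearMap.proj (R := ℝ) k)) z :=
  HasFDerivAt.fun_sum fun k _ => hasFDerivAt_normSq_apply k z

theorem hasFDerivAt_normSqSum_apply (z b : ι → ℂ) :
    (∑ k, (2 : ℝ) • Complex.reCLM.comp
      ((star (z k)) • ContinuousLinearMap.proj (R := ℝ) k) : (ι → ℂ) →L[ℝ] ℝ) b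
      = 2 * (herm z b).re := by
  simp [herm, Finset.mul_sum]

/-- The Cauchy–Schwarz inequality. -/
theorem normSq_herm_le (a b : ι → ℂ) : ‖herm a b‖ ^ 2 ≤ normSqSum a * normSqSum b := by
  have h1 : ‖herm a b‖ ≤ ∑ k, ‖a k‖ * ‖b k‖ := by
    refine (norm_sum_le _ _).trans (le_of_eq ?_)
    simp
  calc ‖herm a b‖ ^ 2 ≤ (∑ k, ‖a k‖ * ‖b k‖) ^ 2 := by gcongr
    _ ≤ _ := Finset.sum_mul_sq_le_sq_mul_sq _ _ _

end herm

/-- The pullback of the Fubini–Study form to `ℂⁿ⁺¹ ∖ {0}`, at `z`, on the vectors `a` and `b`. -/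
def liftForm {n : ℕ} (z a b : Fin (n + 1) → ℂ) : ℝ :=
  (normSqSum z * herm a b - herm a z * herm z b).im / (Real.pi * normSqSum z ^ 2)

/-- The derivative of `affineVec j`, which inserts a `0` at position `j`. -/
def affineTangent {n : ℕ} (j : Fin (n + 1)) (u : Cn n) : Fin (n + 1) → ℂ :=
  Fin.insertNth (α := fun _ => ℂ) j 0 u

@[simp]
theorem affineTangent_self {n : ℕ} (j : Fin (n + 1)) (u : Cn n) : affineTangent j u j = 0 := by
  simp [affineTangent]

@[simp]
theorem affineTangent_succAbove {n : ℕ} (j : Fin (n + 1)) (u : Cn n) (k : Fin n) :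
    affineTangent j u (j.succAbove k) = u k := by
  simp [affineTangent]

theorem normSqSum_affineVec {n : ℕ} (j : Fin (n + 1)) (w : Cn n) :
    normSqSum (affineVec j w) = 1 + ∑ k, ‖w k‖ ^ 2 := by
  simp [normSqSum, Fin.sum_univ_succAbove _ j, affineVec_self, affineVec_succAbove]

theorem fubiniStudyAffine_eq_liftForm {n : ℕ} (j : Fin (n + 1)) (w u v : Cn n) :
    fubiniStudyAffine w u v = liftForm (affineVec j w) (affineTangent j u) (affineTangent j v) := by
  rw [liftForm, normSqSum_affineVec]
  have h1 : herm (affineTangent j u) (affineTangent j v) = ∑ k, star (u k) * v k := by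
    simp [herm, Fin.sum_univ_succAbove _ j]
  have h2 : herm (affineTangent j u) (affineVec j w) = ∑ k, star (u k) * w k := by
    simp [herm, Fin.sum_univ_succAbove _ j, affineVec_succAbove]
  have h3 : herm (affineVec j w) (affineTangent j v) = ∑ k, star (w k) * v k := by
    simp [herm, Fin.sum_univ_succAbove _ j, affineVec_succAbove]
  rw [h1, h2, h3, Complex.sub_im, Complex.im_ofReal_mul]
  rfl

/-- `liftForm` is invariant under scaling and vanishes along the fibres of `ℂⁿ⁺¹ ∖ {0} → ℂPⁿ`. -/
theorem liftForm_smul {n : ℕ} {c : ℂ} (hc : c ≠ 0) (r : ℂ) (z a b : Fin (n + 1) → ℂ) :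
    liftForm (c • z) (c • a + r • z) (c • b) = liftForm z a b := by
  have hc' : (‖c‖ : ℝ) ^ 2 ≠ 0 := by simpa using hc
  have e : star c * c = ((‖c‖ ^ 2 : ℝ) : ℂ) := by
    rw [Complex.star_def, Complex.conj_mul']; push_cast; rfl
  have : (normSqSum (c • z) : ℂ) * herm (c • a + r • z) (c • b)
      - herm (c • a + r • z) (c • z) * herm (c • z) (c • b)
      = (((‖c‖ ^ 2) ^ 2 : ℝ) : ℂ) * (normSqSum z * herm a b - herm a z * herm z b) := by
    rw [normSqSum_smul, Complex.ofReal_mul, Complex.ofReal_pow (‖c‖ ^ 2) 2, ← e]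
    simp only [herm_add_left, herm_smul_left, herm_smul_right, herm_self]
    ring
  rw [liftForm, this, Complex.im_ofReal_mul, normSqSum_smul, liftForm, mul_pow,
    mul_left_comm Real.pi, mul_div_mul_left _ _ (pow_ne_zero 2 hc')]

/-- For `y = Pz` with `P` Hermitian, the hypothesis holds, and the equation says that the linear
vector field `iPz` is Hamiltonian for `⟨Pz, z⟩ / (2π|z|²)`. -/
theorem liftForm_I_smul {n : ℕ} (z y b : Fin (n + 1) → ℂ) (hy : (herm y z).im = 0) :
    liftForm z (Complex.I • y) b = -((normSqSum z * (herm y b).re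
      - (herm y z).re * (herm z b).re) / (Real.pi * normSqSum z ^ 2)) := by
  have e : (normSqSum z : ℂ) * herm (Complex.I • y) b - herm (Complex.I • y) z * herm z b
      = -(Complex.I * (normSqSum z * herm y b - herm y z * herm z b)) := by
    rw [herm_smul_left, herm_smul_left, Complex.star_def, Complex.conj_I]
    ring
  rw [liftForm, e, Complex.neg_im, Complex.I_mul_im, Complex.sub_re, Complex.re_ofReal_mul,
    Complex.mul_re, hy, zero_mul, sub_zero, neg_div]

/-- `ω` tames the complex structure: `ω(u, iu)` is bounded below by a multiple of `|u|²`. -/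
theorem fubiniStudyAffine_I_smul_pos {n : ℕ} (w : Cn n) {u : Cn n} (hu : u ≠ 0) :
    0 < fubiniStudyAffine w u (Complex.I • u) := by
  have e : fubiniStudyAffine w u (Complex.I • u)
      = ((1 + normSqSum w) * normSqSum u - ‖herm w u‖ ^ 2)
        / (Real.pi * (1 + normSqSum w) ^ 2) := by
    have h1 : (∑ k, star (u k) * (Complex.I • u) k) = Complex.I * normSqSum u := by
      rw [← herm_self, ← herm_smul_right]; rfl
    have h2 : (∑ k, star (u k) * w k) * (∑ k, star (w k) * (Complex.I • u) k)
        = Complex.I * ((‖herm w u‖ ^ 2 : ℝ) : ℂ) := by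
      change herm u w * herm w (Complex.I • u) = _
      rw [herm_smul_right, ← star_herm w u, Complex.star_def, mul_left_comm, Complex.conj_mul']
      push_cast; rfl
    rw [fubiniStudyAffine, h1, h2, Complex.I_mul_im, Complex.I_mul_im, Complex.ofReal_re,
      Complex.ofReal_re]
    rfl
  rw [e]
  have h1 := normSq_herm_le w u
  have h2 := normSqSum_pos hu
  have h3 := normSqSum_nonneg w
  have h4 := Real.pi_pos
  apply div_pos
  · nlinarith
  · positivity

theorem fubiniStudyAffine_sub_left {n : ℕ} (w u u' v : Cn n) :
    fubiniStudyAffine w (u - u') v = fubiniStudyAffine w u v - fubiniStudyAffine w u' v := by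
  simp only [fubiniStudyAffine, Pi.sub_apply, star_sub, sub_mul, Finset.sum_sub_distrib,
    Complex.sub_im]
  ring

/-- Nondegeneracy of `ω`. -/
theorem fubiniStudyAffine_injective {n : ℕ} {w u u' : Cn n}
    (h : ∀ v, fubiniStudyAffine w u v = fubiniStudyAffine w u' v) : u = u' := by
  by_contra hne
  have := fubiniStudyAffine_I_smul_pos w (sub_ne_zero.2 hne)
  rw [fubiniStudyAffine_sub_left, h] at this
  simp at this

/-! ### Calculus on projective space through lifts -/

/-- The index of the affine chart that is the preferred chart at `p`. -/
def chartIdx {n : ℕ} (p : CP n) : Fin (n + 1) := (exists_mem_chartDomain p).choose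

theorem mem_chartDomain_chartIdx {n : ℕ} (p : CP n) : p ∈ chartDomain (chartIdx p) :=
  (exists_mem_chartDomain p).choose_spec

theorem chartIdx_mk_ne_zero {n : ℕ} {z : Fin (n + 1) → ℂ} (hz : z ≠ 0) :
    z (chartIdx (Projectivization.mk ℂ z hz)) ≠ 0 :=
  (mk_mem_chartDomain _ z hz).1 (mem_chartDomain_chartIdx _)

theorem affineVec_eq_smul {n : ℕ} {j : Fin (n + 1)} {z : Fin (n + 1) → ℂ} (hz : z ≠ 0)
    (hj : z j ≠ 0) : affineVec j (affineCoord j (Projectivization.mk ℂ z hz)) = (z j)⁻¹ • z := by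
  rw [affineCoord_mk]
  ext k
  rcases Fin.eq_self_or_eq_succAbove j k with rfl | ⟨l, rfl⟩
  · simp [affineVec_self, hj]
  · simp [affineVec_succAbove, div_eq_inv_mul]

theorem smul_affineVec {n : ℕ} {j : Fin (n + 1)} {z : Fin (n + 1) → ℂ} (hz : z ≠ 0)
    (hj : z j ≠ 0) : z j • affineVec j (affineCoord j (Projectivization.mk ℂ z hz)) = z := by
  rw [affineVec_eq_smul hz hj, smul_smul, mul_inv_cancel₀ hj, one_smul]

theorem mk_smul_affineVec {n : ℕ} {j : Fin (n + 1)} {c : ℂ} (hc : c ≠ 0) (w : Cn n) :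
    Projectivization.mk ℂ (c • affineVec j w) (smul_ne_zero hc (affineVec_ne_zero j w))
      = affinePoint j w :=
  (Projectivization.mk_eq_mk_iff' _ _ _ _ _).2 ⟨c, rfl⟩

/-- `affineTangent j` as a continuous linear map. -/
def affineTangentL {n : ℕ} (j : Fin (n + 1)) : Cn n →L[ℝ] (Fin (n + 1) → ℂ) :=
  LinearMap.toContinuousLinearMap
    { toFun := affineTangent j
      map_add' := fun u v => by
        ext k
        rcases Fin.eq_self_or_eq_succAbove j k with rfl | ⟨l, rfl⟩ <;> simp
      map_smul' := fun c u => by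
        ext k
        rcases Fin.eq_self_or_eq_succAbove j k with rfl | ⟨l, rfl⟩ <;> simp }

@[simp]
theorem affineTangentL_apply {n : ℕ} (j : Fin (n + 1)) (u : Cn n) :
    affineTangentL j u = affineTangent j u := rfl

theorem affineVec_eq_add {n : ℕ} (j : Fin (n + 1)) (w : Cn n) :
    affineVec j w = affineTangentL j w + Pi.single j 1 := by
  ext k
  rcases Fin.eq_self_or_eq_succAbove j k with rfl | ⟨l, rfl⟩ <;>
    simp [affineVec_self, affineVec_succAbove]

theorem hasFDerivAt_affineVec {n : ℕ} (j : Fin (n + 1)) (w : Cn n) :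
    HasFDerivAt (affineVec j) (affineTangentL j) w := by
  have : affineVec (n := n) j = fun w => affineTangentL j w + Pi.single j 1 :=
    funext (affineVec_eq_add j)
  rw [this]
  exact (affineTangentL j).hasFDerivAt.add_const _

theorem contDiff_affineVec {n : ℕ} (j : Fin (n + 1)) : ContDiff ℝ ∞ (affineVec (n := n) j) := by
  have : affineVec (n := n) j = fun w => affineTangentL j w + Pi.single j 1 :=
    funext (affineVec_eq_add j)
  rw [this]
  exact (affineTangentL j).contDiff.add contDiff_const

/-- The derivative at `z` of `z ↦ [z]`, read in the `j`-th affine chart. -/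
def projDeriv {n : ℕ} (j : Fin (n + 1)) (z a : Fin (n + 1) → ℂ) : Cn n :=
  fun k => (a (j.succAbove k) * z j - z (j.succAbove k) * a j) / z j ^ 2

theorem affineTangent_projDeriv {n : ℕ} {j : Fin (n + 1)} {z : Fin (n + 1) → ℂ} (hj : z j ≠ 0)
    (a : Fin (n + 1) → ℂ) :
    affineTangent j (projDeriv j z a) = (z j)⁻¹ • a + (-a j / z j ^ 2) • z := by
  ext k
  rcases Fin.eq_self_or_eq_succAbove j k with rfl | ⟨l, rfl⟩
  · simp; field_simp; ring
  · simp [projDeriv]; field_simp; ring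

/-- `K` is a lift of the function `H` on `ℂPⁿ` to `ℂⁿ⁺¹ ∖ {0}`. -/
def IsLift {n : ℕ} (H : CP n → ℝ) (K : (Fin (n + 1) → ℂ) → ℝ) : Prop :=
  ∀ v hv, H (Projectivization.mk ℂ v hv) = K v

theorem IsLift.continuous {n : ℕ} {H : CP n → ℝ} {K : (Fin (n + 1) → ℂ) → ℝ}
    (hHK : IsLift H K) (hK : ∀ z, z ≠ 0 → ContinuousAt K z) : Continuous H := by
  rw [(isQuotientMap_mk n).continuous_iff]
  have : H ∘ (fun v : {v : Fin (n + 1) → ℂ // v ≠ 0} => Projectivization.mk ℂ v.1 v.2)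
      = fun v => K v.1 := funext fun v => hHK v.1 v.2
  rw [this]
  exact continuous_iff_continuousAt.2 fun v =>
    ContinuousAt.comp (f := Subtype.val) (hK v.1 v.2) continuous_subtype_val.continuousAt

theorem IsLift.contMDiff {n : ℕ} {H : CP n → ℝ} {K : (Fin (n + 1) → ℂ) → ℝ}
    (hHK : IsLift H K) (hK : ∀ z, z ≠ 0 → ContDiffAt ℝ ∞ K z) :
    ContMDiff 𝓘(ℝ, Cn n) 𝓘(ℝ, ℝ) ∞ H := by
  intro p
  rw [contMDiffAt_iff]
  refine ⟨(hHK.continuous fun z hz => (hK z hz).continuousAt).continuousAt,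
    ContDiffAt.contDiffWithinAt ?_⟩
  have h : ContDiffAt ℝ ∞ (fun w => K (affineVec (chartIdx p) w)) (affineCoord (chartIdx p) p) :=
    ContDiffAt.comp _ (hK _ (affineVec_ne_zero _ _)) (contDiff_affineVec _).contDiffAt
  refine h.congr_of_eventuallyEq (Filter.Eventually.of_forall fun w => ?_)
  exact hHK _ _

theorem IsLift.isSmoothHamiltonian {n : ℕ} {H : CP n → ℝ} {K : (Fin (n + 1) → ℂ) → ℝ}
    (hHK : IsLift H K) (hK : ∀ z, z ≠ 0 → ContDiffAt ℝ ∞ K z) :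
    IsSmoothHamiltonian (fun _ => H) :=
  ((hHK.contMDiff hK).comp contMDiff_snd).contMDiffOn

theorem IsLift.hasMFDerivAt {n : ℕ} {H : CP n → ℝ} {K : (Fin (n + 1) → ℂ) → ℝ}
    (hHK : IsLift H K) (hK : ∀ z, z ≠ 0 → ContDiffAt ℝ ∞ K z) {z : Fin (n + 1) → ℂ}
    (hz : z ≠ 0) {L : (Fin (n + 1) → ℂ) →L[ℝ] ℝ} (hL : HasFDerivAt K L z) :
    HasMFDerivAt 𝓘(ℝ, Cn n) 𝓘(ℝ, ℝ) H (Projectivization.mk ℂ z hz)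
      (L.comp (z (chartIdx (Projectivization.mk ℂ z hz)) •
        affineTangentL (chartIdx (Projectivization.mk ℂ z hz))) : Cn n →L[ℝ] ℝ) := by
  refine ⟨(hHK.continuous fun z hz => (hK z hz).continuousAt).continuousAt, ?_⟩
  have hj := chartIdx_mk_ne_zero hz
  set p := Projectivization.mk ℂ z hz with hp
  set j := chartIdx p with hjdef
  have h1 : HasFDerivAt (fun w => z j • affineVec j w) (z j • affineTangentL j)
      (affineCoord j p) := (hasFDerivAt_affineVec j _).const_smul (z j)
  have h2 : HasFDerivAt K L (z j • affineVec j (affineCoord j p)) := by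
    rwa [smul_affineVec hz hj]
  have h3 : HasFDerivAt (fun w => H (affinePoint j w)) (L.comp (z j • affineTangentL j))
      (affineCoord j p) := by
    refine (HasFDerivAt.comp (f := fun w => z j • affineVec j w) (affineCoord j p) h2
      h1).congr_of_eventuallyEq (Filter.Eventually.of_forall fun w => ?_)
    change H (affinePoint j w) = K (z j • affineVec j w)
    rw [← mk_smul_affineVec hj, hHK]
  exact h3.hasFDerivWithinAt

/-- The Hamilton equation may be checked on lifts to `ℂⁿ⁺¹ ∖ {0}`. -/
theorem IsLift.isHamiltonianVector {n : ℕ} {H : CP n → ℝ} {K : (Fin (n + 1) → ℂ) → ℝ}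
    (hHK : IsLift H K) (hK : ∀ z, z ≠ 0 → ContDiffAt ℝ ∞ K z) {z : Fin (n + 1) → ℂ}
    (hz : z ≠ 0) {L : (Fin (n + 1) → ℂ) →L[ℝ] ℝ} (hL : HasFDerivAt K L z)
    {a : Fin (n + 1) → ℂ} (ha : ∀ b, liftForm z a b = -L b) :
    IsHamiltonianVector H (Projectivization.mk ℂ z hz)
      (projDeriv (chartIdx (Projectivization.mk ℂ z hz)) z a) := by
  intro (v : Cn n)
  rw [(hHK.hasMFDerivAt hK hz hL).mfderiv]
  have hj := chartIdx_mk_ne_zero hz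
  set p := Projectivization.mk ℂ z hz with hp
  set j := chartIdx p with hjdef
  change fubiniStudyAffine (affineCoord j p) (projDeriv j z a) v
    = -L (z j • affineTangent j v)
  have e : affineTangent j v = (z j)⁻¹ • (z j • affineTangent j v) := by
    rw [smul_smul, inv_mul_cancel₀ hj, one_smul]
  rw [fubiniStudyAffine_eq_liftForm j, affineTangent_projDeriv hj, affineVec_eq_smul hz hj,
    ← ha]
  conv_lhs => rw [e]
  exact liftForm_smul (inv_ne_zero hj) _ _ _ _

theorem IsHamiltonianVector.unique {n : ℕ} {H : CP n → ℝ} {p : CP n}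
    {X Y : TangentSpace 𝓘(ℝ, Cn n) p} (hX : IsHamiltonianVector H p X)
    (hY : IsHamiltonianVector H p Y) : X = Y :=
  fubiniStudyAffine_injective fun v => (hX v).trans (hY v).symm

theorem continuousWithinAt_mk {n : ℕ} {α : Type*} [TopologicalSpace α] {s : Set α}
    {z : α → Fin (n + 1) → ℂ} (hz : ∀ t, z t ≠ 0) {t : α} (h : ContinuousWithinAt z s t) :
    ContinuousWithinAt (fun t => Projectivization.mk ℂ (z t) (hz t)) s t :=
  (isQuotientMap_mk n).continuous.continuousAt.comp_continuousWithinAt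
    (f := fun t => (⟨z t, hz t⟩ : {v : Fin (n + 1) → ℂ // v ≠ 0})) (tendsto_subtype_rng.2 h)

/-- The velocity of the curve `[z(t)]` is the projection of `z'(t)`. -/
theorem hasMFDerivWithinAt_mk {n : ℕ} {z : ℝ → Fin (n + 1) → ℂ} (hz : ∀ t, z t ≠ 0)
    {s : Set ℝ} {t : ℝ} {a : Fin (n + 1) → ℂ} (h : HasDerivWithinAt z a s t) :
    HasMFDerivWithinAt 𝓘(ℝ, ℝ) 𝓘(ℝ, Cn n) (fun t => Projectivization.mk ℂ (z t) (hz t)) s t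
      ((1 : ℝ →L[ℝ] ℝ).smulRight
        (projDeriv (chartIdx (Projectivization.mk ℂ (z t) (hz t))) (z t) a) : ℝ →L[ℝ] Cn n) := by
  refine ⟨continuousWithinAt_mk hz h.continuousWithinAt, ?_⟩
  have hj := chartIdx_mk_ne_zero (hz t)
  set j := chartIdx (Projectivization.mk ℂ (z t) (hz t)) with hjdef
  have hk := hasDerivWithinAt_pi.1 h
  have h1 : HasDerivWithinAt (fun r (k : Fin n) => z r (j.succAbove k) / z r j)
      (projDeriv j (z t) a) s t :=
    hasDerivWithinAt_pi.2 fun k => (hk _).fun_div (hk j) hj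
  have h2 : HasDerivWithinAt
      (fun r => affineCoord j (Projectivization.mk ℂ (z r) (hz r))) (projDeriv j (z t) a) s t := by
    simpa only [affineCoord_mk] using h1
  have h3 : HasFDerivWithinAt (fun r => affineCoord j (Projectivization.mk ℂ (z r) (hz r)))
      ((1 : ℝ →L[ℝ] ℝ).smulRight (projDeriv j (z t) a)) (s ∩ range id) t := by
    refine (h2.hasFDerivWithinAt.mono inter_subset_left).congr_fderiv ?_
    ext
    simp
  exact h3

/-- A differentiable curve in `ℂPⁿ` has a local lift to `ℂⁿ⁺¹ ∖ {0}`, through the preferred chart at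
a point. -/
theorem exists_lift_of_hasMFDerivWithinAt {n : ℕ} {γ : ℝ → CP n} {s : Set ℝ} {t : ℝ}
    {X : Cn n} (h : HasMFDerivWithinAt 𝓘(ℝ, ℝ) 𝓘(ℝ, Cn n) γ s t
      ((1 : ℝ →L[ℝ] ℝ).smulRight X : ℝ →L[ℝ] Cn n)) :
    (∀ᶠ r in 𝓝[s] t, γ r ∈ chartDomain (chartIdx (γ t))) ∧
    HasDerivWithinAt (fun r => affineVec (chartIdx (γ t)) (affineCoord (chartIdx (γ t)) (γ r)))
      (affineTangent (chartIdx (γ t)) X) s t := by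
  have h1 : (chartDomain (chartIdx (γ t))) ∈ 𝓝 (γ t) :=
    (isOpen_chartDomain _).mem_nhds (mem_chartDomain_chartIdx _)
  refine ⟨h.1 h1, ?_⟩
  have h2 : HasFDerivWithinAt (fun r => affineCoord (chartIdx (γ t)) (γ r))
      ((1 : ℝ →L[ℝ] ℝ).smulRight X) (s ∩ range id) t := h.2
  rw [range_id, inter_univ] at h2
  have h3 := (hasFDerivAt_affineVec (chartIdx (γ t)) _).comp_hasFDerivWithinAt t h2
  refine h3.hasDerivWithinAt.congr_deriv ?_
  simp

/-! ### Torus-invariant Hamiltonians and their flows -/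

/-- The moment map in homogeneous coordinates. -/
def liftMoment {n : ℕ} (z : Fin (n + 1) → ℂ) : Fin n → ℝ :=
  fun k => ‖z k.succ‖ ^ 2 / normSqSum z

theorem momentMap_mk {n : ℕ} (z : Fin (n + 1) → ℂ) (hz : z ≠ 0) :
    momentMap (Projectivization.mk ℂ z hz) = liftMoment z := by
  obtain ⟨c, hc, h⟩ := exists_rep_mk z hz
  ext k
  have hc' : ‖c‖ ^ 2 ≠ 0 := by simpa using hc
  have := normSqSum_smul c z
  rw [normSqSum] at this
  rw [momentMap, h, this]
  simp only [liftMoment, Pi.smul_apply, smul_eq_mul, norm_mul, mul_pow]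
  exact mul_div_mul_left _ _ hc'

theorem isLift_comp_momentMap {n : ℕ} (G : (Fin n → ℝ) → ℝ) :
    IsLift (fun p => G (momentMap p)) (fun z => G (liftMoment z)) :=
  fun v hv => congrArg G (momentMap_mk v hv)

theorem contDiffAt_liftMoment {n : ℕ} {z : Fin (n + 1) → ℂ} (hz : z ≠ 0) :
    ContDiffAt ℝ ∞ liftMoment z :=
  contDiffAt_pi.2 fun k => ContDiffAt.div ((contDiff_apply ℝ ℂ k.succ).norm_sq ℝ).contDiffAt
    contDiff_normSqSum.contDiffAt (normSqSum_pos hz).ne'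

theorem continuous_momentMap {n : ℕ} : Continuous (momentMap (n := n)) :=
  continuous_pi fun k => IsLift.continuous (K := fun z => liftMoment z k)
    (isLift_comp_momentMap fun x => x k) fun _ hz =>
      (continuous_apply k).continuousAt.comp (contDiffAt_liftMoment hz).continuousAt

theorem contDiffAt_comp_liftMoment {n : ℕ} {G : (Fin n → ℝ) → ℝ} (hG : ContDiff ℝ ∞ G)
    (z : Fin (n + 1) → ℂ) (hz : z ≠ 0) : ContDiffAt ℝ ∞ (fun z => G (liftMoment z)) z :=
  hG.contDiffAt.comp z (contDiffAt_liftMoment hz)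

/-- The angular velocities of the flow of `G ∘ Φ` on the torus over `x`. -/
def angularVelocity {n : ℕ} (G : (Fin n → ℝ) → ℝ) (x : Fin n → ℝ) : Fin (n + 1) → ℝ :=
  Fin.cons 0 fun k => 2 * Real.pi * fderiv ℝ G x (Pi.single k 1)

/-- Rotation of each homogeneous coordinate `z_k` by the angle `θ_k`. -/
def rotate {n : ℕ} (θ : Fin (n + 1) → ℝ) (z : Fin (n + 1) → ℂ) : Fin (n + 1) → ℂ :=
  fun k => Complex.exp (θ k * Complex.I) * z k

theorem norm_rotate {n : ℕ} (θ : Fin (n + 1) → ℝ) (z : Fin (n + 1) → ℂ) (k : Fin (n + 1)) :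
    ‖rotate θ z k‖ = ‖z k‖ := by
  simp [rotate, Complex.norm_exp_ofReal_mul_I]

theorem rotate_ne_zero {n : ℕ} (θ : Fin (n + 1) → ℝ) {z : Fin (n + 1) → ℂ} (hz : z ≠ 0) :
    rotate θ z ≠ 0 := by
  obtain ⟨k, hk⟩ := Function.ne_iff.1 hz
  refine Function.ne_iff.2 ⟨k, ?_⟩
  rw [Pi.zero_apply, ← norm_ne_zero_iff, norm_rotate]
  exact norm_ne_zero_iff.2 hk

theorem liftMoment_rotate {n : ℕ} (θ : Fin (n + 1) → ℝ) (z : Fin (n + 1) → ℂ) :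
    liftMoment (rotate θ z) = liftMoment z := by
  ext k
  simp [liftMoment, normSqSum, norm_rotate]

theorem rotate_smul {n : ℕ} (θ : Fin (n + 1) → ℝ) (c : ℂ) (z : Fin (n + 1) → ℂ) :
    rotate θ (c • z) = c • rotate θ z := by
  ext k
  simp only [rotate, Pi.smul_apply, smul_eq_mul]
  ring

theorem rotate_rotate {n : ℕ} (θ η : Fin (n + 1) → ℝ) (z : Fin (n + 1) → ℂ) :
    rotate θ (rotate η z) = rotate (θ + η) z := by
  ext k
  simp only [rotate, Pi.add_apply, Complex.ofReal_add, add_mul, Complex.exp_add]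
  ring

theorem rotate_zero {n : ℕ} (z : Fin (n + 1) → ℂ) : rotate 0 z = z := by
  ext k
  simp [rotate]

theorem hasDerivAt_rotate {n : ℕ} (θ : Fin (n + 1) → ℝ) (z : Fin (n + 1) → ℂ) (t : ℝ) :
    HasDerivAt (fun s : ℝ => rotate (s • θ) z)
      (Complex.I • fun k => θ k * rotate (t • θ) z k) t := by
  refine hasDerivAt_pi.2 fun k => ?_
  have h1 : HasDerivAt (fun s : ℝ => ((s * θ k : ℝ) : ℂ) * Complex.I) (θ k * Complex.I) t := by
    simpa using ((hasDerivAt_id t).mul_const (θ k)).ofReal_comp.mul_const Complex.I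
  refine (h1.cexp.mul_const (z k)).congr_deriv ?_
  simp only [rotate, Pi.smul_apply, smul_eq_mul]
  ring

/-- The time `t` map of the flow of `G ∘ Φ`. -/
def torusFlow {n : ℕ} (G : (Fin n → ℝ) → ℝ) (t : ℝ) (p : CP n) : CP n :=
  Projectivization.mk ℂ (rotate (t • angularVelocity G (momentMap p)) p.rep)
    (rotate_ne_zero _ p.rep_nonzero)

theorem torusFlow_mk {n : ℕ} (G : (Fin n → ℝ) → ℝ) (t : ℝ) (z : Fin (n + 1) → ℂ) (hz : z ≠ 0) :
    torusFlow G t (Projectivization.mk ℂ z hz) = Projectivization.mk ℂ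
      (rotate (t • angularVelocity G (liftMoment z)) z) (rotate_ne_zero _ hz) := by
  obtain ⟨c, hc, h⟩ := exists_rep_mk z hz
  rw [torusFlow, Projectivization.mk_eq_mk_iff']
  exact ⟨c, by rw [h, rotate_smul, momentMap_mk]⟩

/-- The derivative of `|z_k|² / |z|²`, by the quotient rule. -/
theorem fderiv_liftMoment_apply {n : ℕ} {z : Fin (n + 1) → ℂ} (hz : z ≠ 0) (k : Fin n)
    (b : Fin (n + 1) → ℂ) :
    fderiv ℝ liftMoment z b k = (2 * (star (z k.succ) * b k.succ).re * normSqSum z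
      - ‖z k.succ‖ ^ 2 * (2 * (herm z b).re)) / normSqSum z ^ 2 := by
  have h1 := hasFDerivAt_pi'.1 ((contDiffAt_liftMoment hz).differentiableAt (by simp)).hasFDerivAt k
  have hN := (normSqSum_pos hz).ne'
  have h2 := (hasFDerivAt_normSq_apply k.succ z).fun_mul
    ((hasDerivAt_inv hN).comp_hasFDerivAt z (hasFDerivAt_normSqSum z))
  have h3 := DFunLike.congr_fun (h1.unique h2) b
  have h4 := hasFDerivAt_normSqSum_apply z b
  simp only [ContinuousLinearMap.comp_apply, ContinuousLinearMap.proj_apply] at h3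
  rw [h3]
  rw [_root_.add_apply, _root_.smul_apply, _root_.smul_apply, _root_.smul_apply, h4]
  simp
  field_simp
  ring

/-- The Hamilton equation for `G ∘ Φ` in homogeneous coordinates. -/
theorem liftForm_angularVelocity {n : ℕ} {G : (Fin n → ℝ) → ℝ} {z : Fin (n + 1) → ℂ}
    (hz : z ≠ 0) (b : Fin (n + 1) → ℂ) :
    liftForm z (Complex.I • fun k => (angularVelocity G (liftMoment z) k : ℂ) * z k) b
      = -(fderiv ℝ G (liftMoment z)).comp (fderiv ℝ liftMoment z) b := by
  set c := angularVelocity G (liftMoment z) with hc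
  have e (d : Fin (n + 1) → ℂ) : herm (fun k => (c k : ℂ) * z k) d
      = ∑ k : Fin n, (c k.succ : ℂ) * (star (z k.succ) * d k.succ) := by
    simp [herm, Fin.sum_univ_succ, hc, angularVelocity, mul_assoc]
  have e1 : herm (fun k => (c k : ℂ) * z k) z
      = ((∑ k : Fin n, c k.succ * ‖z k.succ‖ ^ 2 : ℝ) : ℂ) := by
    rw [e, Complex.ofReal_sum]
    refine Finset.sum_congr rfl fun k _ => ?_
    rw [Complex.star_def, Complex.conj_mul']
    push_cast
    rfl
  have e2 (x : Fin n → ℝ) : fderiv ℝ G (liftMoment z) x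
      = ∑ k, x k * (c k.succ / (2 * Real.pi)) := by
    rw [show fderiv ℝ G (liftMoment z) x = _ from
      (fderiv ℝ G (liftMoment z)).toLinearMap.pi_apply_eq_sum_univ x]
    refine Finset.sum_congr rfl fun k _ => ?_
    have : c k.succ = 2 * Real.pi * fderiv ℝ G (liftMoment z) (Pi.single k 1) := by
      simp [hc, angularVelocity]
    rw [this, smul_eq_mul]
    field_simp
    congr 1
    refine congrArg (fderiv ℝ G (liftMoment z)) ?_
    ext i
    simp [Pi.single_apply, eq_comm]
  have hN := (normSqSum_pos hz).ne'
  rw [liftForm_I_smul _ _ _ (by rw [e1, Complex.ofReal_im]), e1, e, Complex.ofReal_re,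
    ContinuousLinearMap.comp_apply, e2, Complex.re_sum, Finset.mul_sum, Finset.sum_mul,
    ← Finset.sum_sub_distrib, Finset.sum_div]
  congr 1
  refine Finset.sum_congr rfl fun k _ => ?_
  rw [fderiv_liftMoment_apply hz, Complex.re_ofReal_mul]
  field_simp

theorem isHamiltonianVector_angularVelocity {n : ℕ} {G : (Fin n → ℝ) → ℝ} (hG : ContDiff ℝ ∞ G)
    {z : Fin (n + 1) → ℂ} (hz : z ≠ 0) :
    IsHamiltonianVector (fun p => G (momentMap p)) (Projectivization.mk ℂ z hz)
      (projDeriv (chartIdx (Projectivization.mk ℂ z hz)) z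
        (Complex.I • fun k => (angularVelocity G (liftMoment z) k : ℂ) * z k)) := by
  refine (isLift_comp_momentMap G).isHamiltonianVector (contDiffAt_comp_liftMoment hG) hz
    (L := (fderiv ℝ G (liftMoment z)).comp (fderiv ℝ liftMoment z)) ?_
    (liftForm_angularVelocity hz)
  exact HasFDerivAt.comp z (hG.differentiable (by simp) _).hasFDerivAt
    ((contDiffAt_liftMoment hz).differentiableAt (by simp)).hasFDerivAt

/-- Along each orbit the moment map, and hence the angular velocity, is constant. -/
theorem isHamiltonianFlow_torusFlow {n : ℕ} {G : (Fin n → ℝ) → ℝ} (hG : ContDiff ℝ ∞ G) :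
    IsHamiltonianFlow (fun _ p => G (momentMap p)) (torusFlow G) where
  init p := by
    simp only [torusFlow, zero_smul, rotate_zero]
    exact p.mk_rep
  hasDeriv p t _ := by
    have h := isHamiltonianVector_angularVelocity hG
      (rotate_ne_zero (t • angularVelocity G (momentMap p)) p.rep_nonzero)
    have e : liftMoment p.rep = momentMap p := rfl
    rw [liftMoment_rotate, e] at h
    exact ⟨_, h, hasMFDerivWithinAt_mk (fun s => rotate_ne_zero _ p.rep_nonzero)
      (hasDerivAt_rotate _ _ t).hasDerivWithinAt⟩

theorem angularVelocity_add {n : ℕ} {F G : (Fin n → ℝ) → ℝ} (hF : ContDiff ℝ ∞ F)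
    (hG : ContDiff ℝ ∞ G) (x : Fin n → ℝ) :
    angularVelocity (F + G) x = angularVelocity F x + angularVelocity G x := by
  ext k
  refine Fin.cases ?_ (fun k => ?_) k
  · simp [angularVelocity]
  · simp [angularVelocity, fderiv_add (hF.differentiable (by simp) x)
      (hG.differentiable (by simp) x), mul_add]

theorem torusFlow_add {n : ℕ} {F G : (Fin n → ℝ) → ℝ} (hF : ContDiff ℝ ∞ F)
    (hG : ContDiff ℝ ∞ G) (t : ℝ) (p : CP n) :
    torusFlow (F + G) t p = torusFlow F t (torusFlow G t p) := by
  rw [torusFlow.eq_def G, torusFlow_mk, torusFlow]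
  simp only [rotate_rotate, liftMoment_rotate, angularVelocity_add hF hG, smul_add]
  rfl

theorem angularVelocity_const {n : ℕ} (c : ℝ) (x : Fin n → ℝ) :
    angularVelocity (fun _ => c) x = 0 := by
  ext k
  refine Fin.cases ?_ (fun k => ?_) k <;> simp [angularVelocity]

theorem torusFlow_const {n : ℕ} (c t : ℝ) (p : CP n) : torusFlow (fun _ => c) t p = p := by
  rw [torusFlow]
  simp only [angularVelocity_const, smul_zero, rotate_zero]
  exact p.mk_rep

/-! ### Uniqueness of the flow and the torus subgroup -/

/-- The barycentric coordinates `|z_i|² / |z|²` of the moment map. -/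
def baryCoord {n : ℕ} (i : Fin (n + 1)) (p : CP n) : ℝ := ‖p.rep i‖ ^ 2 / normSqSum p.rep

theorem momentMap_apply {n : ℕ} (p : CP n) (k : Fin n) : momentMap p k = baryCoord k.succ p := rfl

theorem baryCoord_mk {n : ℕ} (i : Fin (n + 1)) (z : Fin (n + 1) → ℂ) (hz : z ≠ 0) :
    baryCoord i (Projectivization.mk ℂ z hz) = ‖z i‖ ^ 2 / normSqSum z := by
  obtain ⟨c, hc, h⟩ := exists_rep_mk z hz
  have hc' : ‖c‖ ^ 2 ≠ 0 := by simpa using hc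
  rw [baryCoord, h, normSqSum_smul]
  simp only [Pi.smul_apply, smul_eq_mul, norm_mul, mul_pow]
  exact mul_div_mul_left _ _ hc'

theorem mem_chartDomain_iff_baryCoord {n : ℕ} {i : Fin (n + 1)} {p : CP n} :
    p ∈ chartDomain i ↔ baryCoord i p ≠ 0 := by
  simp [chartDomain, baryCoord, (normSqSum_pos p.rep_nonzero).ne']

/-- The Hamiltonian vector of `G ∘ Φ` is the infinitesimal rotation with angular velocities
`∂G`, up to a multiple of the radial vector. -/
theorem IsHamiltonianVector.affineTangent_eq {n : ℕ} {G : (Fin n → ℝ) → ℝ} (hG : ContDiff ℝ ∞ G)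
    {p : CP n} {X : TangentSpace 𝓘(ℝ, Cn n) p}
    (hX : IsHamiltonianVector (fun p => G (momentMap p)) p X) :
    ∃ r : ℂ, ∀ k, affineTangent (chartIdx p) (X : Cn n) k
      = (Complex.I * angularVelocity G (momentMap p) k + r)
        * affineVec (chartIdx p) (affineCoord (chartIdx p) p) k := by
  set j := chartIdx p with hj
  set z := affineVec j (affineCoord j p) with hz
  have hz0 : z ≠ 0 := affineVec_ne_zero _ _
  have hzj : z j = 1 := affineVec_self _ _
  have hp : Projectivization.mk ℂ z hz0 = p :=
    affinePoint_affineCoord j p (mem_chartDomain_chartIdx p)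
  have hm : liftMoment z = momentMap p := by rw [← hp, momentMap_mk]
  have h := isHamiltonianVector_angularVelocity hG hz0
  rw [hm, hp] at h
  have hXY := hX.unique h
  have e : affineTangent j (X : Cn n) = affineTangent j (projDeriv j z
      (Complex.I • fun k => (angularVelocity G (momentMap p) k : ℂ) * z k)) :=
    congrArg (affineTangent j) hXY
  rw [e, affineTangent_projDeriv (by rw [hzj]; exact one_ne_zero), hzj]
  refine ⟨-(Complex.I * angularVelocity G (momentMap p) j), fun k => ?_⟩
  simp [hzj]
  ring

section uniqueness

variable {n : ℕ} {G : (Fin n → ℝ) → ℝ} {φ : ℝ → CP n → CP n}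

/-- The flow equation of `G ∘ Φ` in homogeneous coordinates. -/
theorem IsHamiltonianFlow.exists_lift (hG : ContDiff ℝ ∞ G)
    (hφ : IsHamiltonianFlow (fun _ p => G (momentMap p)) φ) (p : CP n) {t : ℝ}
    (ht : t ∈ Icc (0 : ℝ) 1) :
    ∃ (z : ℝ → Fin (n + 1) → ℂ) (hz : ∀ s, z s ≠ 0) (r : ℂ),
      (∀ᶠ s in 𝓝[Icc 0 1] t, φ s p = Projectivization.mk ℂ (z s) (hz s)) ∧
      ∀ k, HasDerivWithinAt (fun s => z s k)
        ((Complex.I * angularVelocity G (momentMap (φ t p)) k + r) * z t k) (Icc 0 1) t := by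
  obtain ⟨X, hX, hX'⟩ := hφ.hasDeriv p t ht
  obtain ⟨h1, h2⟩ := exists_lift_of_hasMFDerivWithinAt hX'
  obtain ⟨r, hr⟩ := hX.affineTangent_eq hG
  refine ⟨fun s => affineVec (chartIdx (φ t p)) (affineCoord (chartIdx (φ t p)) (φ s p)),
    fun s => affineVec_ne_zero _ _, r, ?_, fun k => ?_⟩
  · filter_upwards [h1] with s hs
    exact (affinePoint_affineCoord _ _ hs).symm
  · have := hasDerivWithinAt_pi.1 h2 k
    rwa [hr k] at this

/-- The torus-invariant Hamiltonian flow preserves the fibres of the moment map. -/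
theorem IsHamiltonianFlow.baryCoord_eq (hG : ContDiff ℝ ∞ G)
    (hφ : IsHamiltonianFlow (fun _ p => G (momentMap p)) φ) (p : CP n) (i : Fin (n + 1)) {t : ℝ}
    (ht : t ∈ Icc (0 : ℝ) 1) : baryCoord i (φ t p) = baryCoord i p := by
  have key : ∀ t ∈ Icc (0 : ℝ) 1,
      HasDerivWithinAt (fun s => baryCoord i (φ s p)) 0 (Icc 0 1) t := by
    intro t ht
    obtain ⟨z, hz, r, h1, h2⟩ := hφ.exists_lift hG p ht
    have h3 : ∀ k, HasDerivWithinAt (fun s => ‖z s k‖ ^ 2) (2 * r.re * ‖z t k‖ ^ 2)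
        (Icc 0 1) t := by
      intro k
      refine (h2 k).norm_sq.congr_deriv ?_
      rw [← Complex.normSq_eq_norm_sq, Complex.normSq_apply]
      simp [Complex.inner]
      ring
    have h4 : HasDerivWithinAt (fun s => normSqSum (z s)) (2 * r.re * normSqSum (z t))
        (Icc 0 1) t :=
      (HasDerivWithinAt.fun_sum fun k _ => h3 k).congr_deriv (by rw [normSqSum, Finset.mul_sum])
    have h5 : HasDerivWithinAt (fun s => ‖z s i‖ ^ 2 / normSqSum (z s)) 0 (Icc 0 1) t := by
      refine ((h3 i).fun_div h4 (normSqSum_pos (hz t)).ne').congr_deriv ?_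
      rw [div_eq_zero_iff]
      left
      ring
    have h6 : ∀ᶠ s in 𝓝[Icc 0 1] t, baryCoord i (φ s p) = ‖z s i‖ ^ 2 / normSqSum (z s) := by
      filter_upwards [h1] with s hs
      rw [hs, baryCoord_mk]
    exact h5.congr_of_eventuallyEq_of_mem h6 ht
  have h := constant_of_derivWithin_zero (fun s hs => (key s hs).differentiableWithinAt)
    (fun s hs => (key s ⟨hs.1, hs.2.le⟩).derivWithin
      (uniqueDiffOn_Icc zero_lt_one s ⟨hs.1, hs.2.le⟩)) t ht
  simpa [hφ.init] using h

/-- Uniqueness of the time-one map of `G ∘ Φ`: in an affine chart, the flow equation becomes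
linear with constant coefficients, as the moment map is preserved. -/
theorem IsHamiltonianFlow.eq_torusFlow (hG : ContDiff ℝ ∞ G)
    (hφ : IsHamiltonianFlow (fun _ p => G (momentMap p)) φ) (p : CP n) :
    φ 1 p = torusFlow G 1 p := by
  have hm : ∀ t ∈ Icc (0 : ℝ) 1, momentMap (φ t p) = momentMap p := fun t ht =>
    funext fun k => hφ.baryCoord_eq hG p k.succ ht
  obtain ⟨j, hj⟩ := exists_mem_chartDomain p
  have hdom : ∀ t ∈ Icc (0 : ℝ) 1, φ t p ∈ chartDomain j := by
    intro t ht
    rw [mem_chartDomain_iff_baryCoord, hφ.baryCoord_eq hG p j ht]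
    exact mem_chartDomain_iff_baryCoord.1 hj
  set c := angularVelocity G (momentMap p) with hc
  -- Each affine coordinate `z_k / z_j` rotates with the constant angular velocity `c_k - c_j`, so
  -- it becomes constant after undoing this rotation.
  have key : ∀ (k : Fin n), ∀ t ∈ Icc (0 : ℝ) 1,
      HasDerivWithinAt (fun s : ℝ =>
        Complex.exp (-((s : ℂ) * (Complex.I * (c (j.succAbove k) - c j))))
          * affineCoord j (φ s p) k) 0 (Icc 0 1) t := by
    intro k t ht
    obtain ⟨z, hz, r, h1, h2⟩ := hφ.exists_lift hG p ht
    rw [hm t ht, ← hc] at h2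
    have ht1 := h1.self_of_nhdsWithin ht
    have hzj : z t j ≠ 0 := by
      rw [← mk_mem_chartDomain j _ (hz t), ← ht1]
      exact hdom t ht
    have h3 : HasDerivWithinAt (fun s => affineCoord j (φ s p) k)
        ((Complex.I * (c (j.succAbove k) - c j)) * affineCoord j (φ t p) k) (Icc 0 1) t := by
      have h4 : ∀ᶠ s in 𝓝[Icc 0 1] t, affineCoord j (φ s p) k = z s (j.succAbove k) / z s j := by
        filter_upwards [h1] with s hs
        rw [hs, affineCoord_mk]
      rw [h4.self_of_nhdsWithin ht]
      refine (((h2 (j.succAbove k)).fun_div (h2 j) hzj).congr_of_eventuallyEq_of_mem h4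
        ht).congr_deriv ?_
      field_simp
      ring
    have h5 : HasDerivWithinAt
        (fun s : ℝ => -((s : ℂ) * (Complex.I * (c (j.succAbove k) - c j))))
        (-(Complex.I * (c (j.succAbove k) - c j))) (Icc 0 1) t := by
      simpa using (((hasDerivAt_id t).ofReal_comp.mul_const
        (Complex.I * (c (j.succAbove k) - c j : ℂ))).fun_neg).hasDerivWithinAt
    refine (h5.cexp.fun_mul h3).congr_deriv ?_
    ring
  have hcoord : affineCoord j (φ 1 p) = affineCoord j (torusFlow G 1 p) := by
    ext k
    have h := constant_of_derivWithin_zero (fun s hs => (key k s hs).differentiableWithinAt)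
      (fun s hs => (key k s ⟨hs.1, hs.2.le⟩).derivWithin
        (uniqueDiffOn_Icc zero_lt_one s ⟨hs.1, hs.2.le⟩)) 1 ⟨zero_le_one, le_rfl⟩
    simp only [Complex.ofReal_one, one_mul, Complex.ofReal_zero, zero_mul, neg_zero,
      Complex.exp_zero, hφ.init] at h
    rw [Complex.exp_neg, inv_mul_eq_iff_eq_mul₀ (Complex.exp_ne_zero _)] at h
    rw [h, torusFlow, affineCoord_mk]
    simp only [affineCoord, rotate, one_smul, ← hc]
    rw [mul_sub, Complex.exp_sub, mul_comm Complex.I, mul_comm Complex.I, mul_div_mul_comm]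
  have hT : torusFlow G 1 p ∈ chartDomain j := by
    rw [torusFlow, mk_mem_chartDomain, ← norm_ne_zero_iff, norm_rotate]
    exact norm_ne_zero_iff.2 hj
  rw [← affinePoint_affineCoord j _ (hdom 1 ⟨zero_le_one, le_rfl⟩), hcoord,
    affinePoint_affineCoord j _ hT]

end uniqueness

/-- The time-one map of `G ∘ Φ`, as a permutation of `ℂPⁿ`. -/
def torusPerm {n : ℕ} (G : (Fin n → ℝ) → ℝ) : Equiv.Perm (CP n) where
  toFun := torusFlow G 1
  invFun := torusFlow G (-1)
  left_inv p := by
    rw [torusFlow.eq_def G 1, torusFlow_mk]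
    simp only [rotate_rotate, liftMoment_rotate]
    simp only [show momentMap p = liftMoment p.rep from rfl, ← add_smul]
    simp only [neg_add_cancel, zero_smul, rotate_zero]
    exact p.mk_rep
  right_inv p := by
    rw [torusFlow.eq_def G (-1), torusFlow_mk]
    simp only [rotate_rotate, liftMoment_rotate]
    simp only [show momentMap p = liftMoment p.rep from rfl, ← add_smul]
    simp only [add_neg_cancel, zero_smul, rotate_zero]
    exact p.mk_rep

theorem isTimeOneMap_torusPerm {n : ℕ} {G : (Fin n → ℝ) → ℝ} (hG : ContDiff ℝ ∞ G) :
    IsTimeOneMap (fun _ p => G (momentMap p)) (torusPerm G) :=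
  ⟨(isLift_comp_momentMap G).isSmoothHamiltonian (contDiffAt_comp_liftMoment hG),
    torusFlow G, isHamiltonianFlow_torusFlow hG, fun _ => rfl⟩

/-- The time-one map of `G ∘ Φ`, as an element of `Ham(ℂPⁿ)`. -/
def torusHam {n : ℕ} (G : (Fin n → ℝ) → ℝ) (hG : ContDiff ℝ ∞ G) : Ham n :=
  ⟨torusPerm G, _, isTimeOneMap_torusPerm hG⟩

theorem IsTimeOneMap.eq_torusHam {n : ℕ} {G : (Fin n → ℝ) → ℝ} (hG : ContDiff ℝ ∞ G) {g : Ham n}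
    (hg : IsTimeOneMap (fun _ p => G (momentMap p)) g) : g = torusHam G hG := by
  obtain ⟨-, φ, hφ, h⟩ := hg
  exact Subtype.ext (Equiv.ext fun x => (h x).symm.trans (hφ.eq_torusFlow hG x))

theorem torusHam_add {n : ℕ} {F G : (Fin n → ℝ) → ℝ} (hF : ContDiff ℝ ∞ F)
    (hG : ContDiff ℝ ∞ G) : torusHam (F + G) (hF.add hG) = torusHam F hF * torusHam G hG :=
  Subtype.ext (Equiv.ext fun p => torusFlow_add hF hG 1 p)

theorem torusHam_const {n : ℕ} (c : ℝ) : torusHam (n := n) (fun _ => c) contDiff_const = 1 :=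
  Subtype.ext (Equiv.ext fun p => torusFlow_const c 1 p)

theorem commute_torusHam {n : ℕ} {F G : (Fin n → ℝ) → ℝ} (hF : ContDiff ℝ ∞ F)
    (hG : ContDiff ℝ ∞ G) : Commute (torusHam F hF) (torusHam G hG) := by
  rw [Commute, SemiconjBy, ← torusHam_add, ← torusHam_add]
  congr 1
  exact add_comm F G

/-! ### Displacing by transpositions of the homogeneous coordinates -/

/-- The orthogonal projection of `ℂⁿ⁺¹` onto the line spanned by `e_i - e_j`. -/
def antisymPart {n : ℕ} (i j : Fin (n + 1)) (z : Fin (n + 1) → ℂ) : Fin (n + 1) → ℂ :=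
  ((z i - z j) / 2) • (Pi.single i 1 - Pi.single j 1)

section swap

variable {n : ℕ} {i j : Fin (n + 1)}

theorem antisymPart_add_smul (hij : i ≠ j) (c : ℂ) (z : Fin (n + 1) → ℂ) :
    antisymPart i j (z + c • antisymPart i j z) = (1 + c) • antisymPart i j z := by
  simp only [antisymPart, smul_smul]
  congr 1
  simp [hij, hij.symm]
  ring

theorem herm_antisymPart (z b : Fin (n + 1) → ℂ) :
    herm (antisymPart i j z) b = star (z i - z j) / 2 * (b i - b j) := by
  rw [antisymPart, herm_smul_left]
  simp only [herm, Pi.sub_apply, star_sub, sub_mul, Finset.sum_sub_distrib]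
  have (i : Fin (n + 1)) : ∑ k, star ((Pi.single i 1 : Fin (n + 1) → ℂ) k) * b k = b i := by
    rw [Finset.sum_eq_single i]
    · simp
    · intro k _ hk
      simp [hk]
    · simp
  rw [this, this]
  simp

/-- The unitary flow `exp(iπtP)`, with `P = antisymPart i j`. At time `1` it is the reflection
`1 - 2P`, which is the transposition of `z_i` and `z_j`. -/
def swapFlow (i j : Fin (n + 1)) (t : ℝ) (z : Fin (n + 1) → ℂ) : Fin (n + 1) → ℂ :=
  z + (Complex.exp (t * (Real.pi * Complex.I)) - 1) • antisymPart i j z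

theorem antisymPart_swapFlow (hij : i ≠ j) (t : ℝ) (z : Fin (n + 1) → ℂ) :
    antisymPart i j (swapFlow i j t z)
      = Complex.exp (t * (Real.pi * Complex.I)) • antisymPart i j z := by
  rw [swapFlow, antisymPart_add_smul hij]
  congr 1
  ring

theorem swapFlow_ne_zero (hij : i ≠ j) (t : ℝ) {z : Fin (n + 1) → ℂ} (hz : z ≠ 0) :
    swapFlow i j t z ≠ 0 := by
  intro h
  have h1 := antisymPart_swapFlow hij t z
  rw [h] at h1
  have h2 : antisymPart i j z = 0 := by
    have h3 : antisymPart i j (0 : Fin (n + 1) → ℂ) = 0 := by simp [antisymPart]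
    rw [h3, eq_comm, smul_eq_zero] at h1
    exact h1.resolve_left (Complex.exp_ne_zero _)
  rw [swapFlow, h2, smul_zero, add_zero] at h
  exact hz h

theorem swapFlow_zero (z : Fin (n + 1) → ℂ) : swapFlow i j 0 z = z := by simp [swapFlow]

theorem swapFlow_one (z : Fin (n + 1) → ℂ) : swapFlow i j 1 z = z ∘ Equiv.swap i j := by
  ext k
  simp only [swapFlow, Complex.ofReal_one, one_mul, Complex.exp_pi_mul_I, antisymPart,
    Pi.add_apply, Pi.smul_apply, Pi.sub_apply, smul_eq_mul, Function.comp_apply]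
  rcases eq_or_ne k i with rfl | hi
  · rcases eq_or_ne k j with rfl | hj
    · simp
    · simp [hj]
      ring
  · rcases eq_or_ne k j with rfl | hj
    · simp [hi]
      ring
    · simp [hi, hj, Equiv.swap_apply_of_ne_of_ne hi hj]

theorem hasDerivAt_swapFlow (hij : i ≠ j) (z : Fin (n + 1) → ℂ) (t : ℝ) :
    HasDerivAt (fun s : ℝ => swapFlow i j s z)
      (Complex.I • (Real.pi : ℂ) • antisymPart i j (swapFlow i j t z)) t := by
  rw [antisymPart_swapFlow hij]
  have h1 : HasDerivAt (fun s : ℝ => (s : ℂ) * (Real.pi * Complex.I)) (Real.pi * Complex.I) t := by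
    simpa using (hasDerivAt_id t).ofReal_comp.mul_const (Real.pi * Complex.I)
  refine (((h1.cexp.sub_const 1).smul_const (antisymPart i j z)).const_add z).congr_deriv ?_
  rw [smul_smul, smul_smul]
  congr 1
  ring

/-- The Hamiltonian `⟨Pz, z⟩ / 2|z|²` of `swapFlow` in homogeneous coordinates, where `P` is
`antisymPart i j`. -/
def liftSwapHamiltonian (i j : Fin (n + 1)) (z : Fin (n + 1) → ℂ) : ℝ :=
  ‖z i - z j‖ ^ 2 / normSqSum z / 4

theorem isLift_swapHamiltonian :
    IsLift (fun p => liftSwapHamiltonian i j p.rep) (liftSwapHamiltonian i j) := by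
  intro v hv
  obtain ⟨c, hc, h⟩ := exists_rep_mk v hv
  have hc' : ‖c‖ ^ 2 ≠ 0 := by simpa using hc
  simp only [liftSwapHamiltonian, h, normSqSum_smul, Pi.smul_apply, ← smul_sub, norm_smul, mul_pow]
  rw [mul_div_mul_left _ _ hc']

theorem contDiffAt_liftSwapHamiltonian (z : Fin (n + 1) → ℂ) (hz : z ≠ 0) :
    ContDiffAt ℝ ∞ (liftSwapHamiltonian i j) z :=
  ((((contDiff_apply ℝ ℂ i).sub (contDiff_apply ℝ ℂ j)).norm_sq ℝ).contDiffAt.div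
    contDiff_normSqSum.contDiffAt (normSqSum_pos hz).ne').div_const 4

theorem liftForm_antisymPart {z : Fin (n + 1) → ℂ} (hz : z ≠ 0) (b : Fin (n + 1) → ℂ) :
    liftForm z (Complex.I • (Real.pi : ℂ) • antisymPart i j z) b
      = -fderiv ℝ (liftSwapHamiltonian i j) z b := by
  have hN := (normSqSum_pos hz).ne'
  have hpi := Real.pi_ne_zero
  have e : star (z i - z j) / 2 * (z i - z j) = ((‖z i - z j‖ ^ 2 / 2 : ℝ) : ℂ) := by
    rw [div_mul_eq_mul_div, Complex.star_def, Complex.conj_mul']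
    push_cast
    rfl
  have e1 : herm ((Real.pi : ℂ) • antisymPart i j z) z
      = ((Real.pi * (‖z i - z j‖ ^ 2 / 2) : ℝ) : ℂ) := by
    rw [herm_smul_left, herm_antisymPart, e]
    simp
  have e2 : herm ((Real.pi : ℂ) • antisymPart i j z) b
      = (Real.pi : ℂ) * (star (z i - z j) / 2 * (b i - b j)) := by
    rw [herm_smul_left, herm_antisymPart]
    simp
  have h0 := (ContinuousLinearMap.proj (R := ℝ) (φ := fun _ : Fin (n + 1) => ℂ) i
    - ContinuousLinearMap.proj (R := ℝ) (φ := fun _ : Fin (n + 1) => ℂ) j).hasFDerivAt (x := z)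
  have h1 := (h0.norm_sq.fun_mul
    ((hasDerivAt_inv hN).comp_hasFDerivAt z (hasFDerivAt_normSqSum z))).mul_const (4⁻¹ : ℝ)
  have h2 : HasFDerivAt (liftSwapHamiltonian i j) _ z := h1
  have h4 := hasFDerivAt_normSqSum_apply z b
  rw [liftForm_I_smul _ _ _ (by rw [e1, Complex.ofReal_im]), e1, e2, Complex.ofReal_re,
    Complex.re_ofReal_mul, h2.fderiv]
  rw [_root_.smul_apply, _root_.add_apply, _root_.smul_apply, _root_.smul_apply,
    _root_.smul_apply, h4]
  simp [Complex.inner]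
  field_simp
  ring

/-- The transposition of the homogeneous coordinates `z_i` and `z_j`. -/
def swapMap (i j : Fin (n + 1)) (p : CP n) : CP n :=
  Projectivization.mk ℂ (p.rep ∘ Equiv.swap i j) fun h => p.rep_nonzero <| funext fun k => by
    simpa using congrFun h (Equiv.swap i j k)

theorem swapMap_mk (z : Fin (n + 1) → ℂ) (hz : z ≠ 0) (hz' : z ∘ Equiv.swap i j ≠ 0) :
    swapMap i j (Projectivization.mk ℂ z hz) = Projectivization.mk ℂ (z ∘ Equiv.swap i j) hz' := by
  obtain ⟨c, hc, h⟩ := exists_rep_mk z hz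
  rw [swapMap, Projectivization.mk_eq_mk_iff']
  exact ⟨c, by rw [h]; rfl⟩

theorem swapMap_involutive : Function.Involutive (swapMap (n := n) i j) := by
  intro p
  have h : (p.rep ∘ Equiv.swap i j) ∘ Equiv.swap i j = p.rep := by ext k; simp
  rw [swapMap.eq_def i j p, swapMap_mk _ _ (by rw [h]; exact p.rep_nonzero)]
  simp only [h, Projectivization.mk_rep]

theorem isTimeOneMap_swapMap (hij : i ≠ j) :
    IsTimeOneMap (fun _ p => liftSwapHamiltonian i j p.rep)
      (swapMap_involutive (i := i) (j := j)).toPerm := by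
  refine ⟨isLift_swapHamiltonian.isSmoothHamiltonian contDiffAt_liftSwapHamiltonian,
    fun t p => Projectivization.mk ℂ (swapFlow i j t p.rep) (swapFlow_ne_zero hij t p.rep_nonzero),
    ⟨fun p => ?_, fun p t _ => ?_⟩, fun p => ?_⟩
  · simp only [swapFlow_zero, Projectivization.mk_rep]
  · have hz := swapFlow_ne_zero hij t p.rep_nonzero
    exact ⟨_, isLift_swapHamiltonian.isHamiltonianVector contDiffAt_liftSwapHamiltonian hz
      ((contDiffAt_liftSwapHamiltonian _ hz).differentiableAt (by simp)).hasFDerivAt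
      (liftForm_antisymPart hz),
      hasMFDerivWithinAt_mk (fun s => swapFlow_ne_zero hij s p.rep_nonzero)
        (hasDerivAt_swapFlow hij _ t).hasDerivWithinAt⟩
  · simp only [swapFlow_one]
    rfl

end swap

theorem continuous_baryCoord {n : ℕ} (i : Fin (n + 1)) : Continuous (baryCoord (n := n) i) :=
  IsLift.continuous (K := fun z => ‖z i‖ ^ 2 / normSqSum z) (baryCoord_mk i) fun _ hz =>
    ((continuous_apply i).norm.pow 2).continuousAt.div continuous_normSqSum.continuousAt
      (normSqSum_pos hz).ne'

theorem baryCoord_nonneg {n : ℕ} (i : Fin (n + 1)) (p : CP n) : 0 ≤ baryCoord i p :=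
  div_nonneg (by positivity) (normSqSum_nonneg _)

theorem baryCoord_swapMap {n : ℕ} (i j k : Fin (n + 1)) (p : CP n) :
    baryCoord k (swapMap i j p) = baryCoord (Equiv.swap i j k) p := by
  have e : normSqSum (p.rep ∘ Equiv.swap i j) = normSqSum p.rep :=
    Equiv.sum_comp (Equiv.swap i j) fun k => ‖p.rep k‖ ^ 2
  rw [swapMap, baryCoord_mk, e]
  rfl

/-- The open set `{|z_j| < |z_i|}`. -/
def dominated {n : ℕ} (i j : Fin (n + 1)) : Set (CP n) := {p | baryCoord j p < baryCoord i p}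

theorem isOpen_dominated {n : ℕ} (i j : Fin (n + 1)) : IsOpen (dominated i j) :=
  isOpen_lt (continuous_baryCoord j) (continuous_baryCoord i)

theorem dominated_nonempty {n : ℕ} {i j : Fin (n + 1)} (hij : i ≠ j) :
    (dominated i j).Nonempty := by
  have h : (Pi.single i 1 : Fin (n + 1) → ℂ) ≠ 0 := by simp
  refine ⟨Projectivization.mk ℂ _ h, ?_⟩
  simp only [dominated, mem_ofPred_eq, baryCoord_mk]
  have := normSqSum_pos h
  simp [hij.symm, this]

/-- The transposition of `z_i` and `z_j` displaces `{|z_j| < |z_i|}`. -/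
theorem displaceable_dominated {n : ℕ} {i j : Fin (n + 1)} (hij : i ≠ j) :
    Displaceable (dominated i j) := by
  refine ⟨⟨_, _, isTimeOneMap_swapMap hij⟩, eq_empty_of_forall_notMem ?_⟩
  rintro _ ⟨⟨p, hp, rfl⟩, hq⟩
  have h : swapMap i j p ∈ {p | baryCoord j p ≤ baryCoord i p} :=
    closure_minimal (fun _ h => le_of_lt h)
      (isClosed_le (continuous_baryCoord j) (continuous_baryCoord i)) hq
  rw [mem_ofPred_eq, baryCoord_swapMap, baryCoord_swapMap, Equiv.swap_apply_left,
    Equiv.swap_apply_right] at h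
  exact not_lt_of_ge h hp

theorem dominated_subset_chartDomain {n : ℕ} (i j : Fin (n + 1)) :
    dominated i j ⊆ chartDomain i := fun p hp =>
  mem_chartDomain_iff_baryCoord.2 ((baryCoord_nonneg j p).trans_lt hp).ne'

/-! ### Exactness of the Fubini–Study form on affine charts -/

/-- The derivative of `affinePoint j` is the projection of `affineTangent j`. -/
theorem mfderiv_affinePoint {n : ℕ} (j : Fin (n + 1)) (w v : Cn n) :
    (mfderiv 𝓘(ℝ, Cn n) 𝓘(ℝ, Cn n) (affinePoint j) w : Cn n →L[ℝ] Cn n) v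
      = projDeriv (chartIdx (affinePoint j w)) (affineVec j w) (affineTangent j v) := by
  set J := chartIdx (affinePoint j w) with hJdef
  have hJ : affineVec j w J ≠ 0 := chartIdx_mk_ne_zero (affineVec_ne_zero j w)
  have hV := hasFDerivAt_affineVec j w
  have hd : DifferentiableAt ℝ
      (fun (w : Cn n) (k : Fin n) => affineVec j w (J.succAbove k) / affineVec j w J) w := by
    simp only [div_eq_mul_inv]
    exact differentiableAt_pi.2 fun k => (differentiableAt_pi.1 hV.differentiableAt _).fun_mul
      ((differentiableAt_pi.1 hV.differentiableAt _).fun_inv hJ)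
  have hd' : HasFDerivAt (fun w => affineCoord J (affinePoint j w)) (fderiv ℝ
      (fun (w : Cn n) (k : Fin n) => affineVec j w (J.succAbove k) / affineVec j w J) w) w :=
    hd.hasFDerivAt.congr_of_eventuallyEq
      (Filter.Eventually.of_forall fun w => affineCoord_mk J _ _)
  have hm : HasMFDerivAt 𝓘(ℝ, Cn n) 𝓘(ℝ, Cn n) (affinePoint j) w (fderiv ℝ
      (fun (w : Cn n) (k : Fin n) => affineVec j w (J.succAbove k) / affineVec j w J) w) :=
    ⟨(continuous_affinePoint j).continuousAt, hd'.hasFDerivWithinAt⟩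
  rw [hm.mfderiv]
  have hline : HasDerivAt (fun t : ℝ => affineVec j (w + t • v)) (affineTangent j v) 0 :=
    hV.hasLineDerivAt v
  have hk := hasDerivAt_pi.1 hline
  have h0 : affineVec j (w + (0 : ℝ) • v) = affineVec j w := by simp
  have h1 : HasDerivAt (fun (t : ℝ) (k : Fin n) =>
      affineVec j (w + t • v) (J.succAbove k) / affineVec j (w + t • v) J)
      (projDeriv J (affineVec j w) (affineTangent j v)) 0 := by
    refine hasDerivAt_pi.2 fun k => ?_
    refine ((hk (J.succAbove k)).fun_div (hk J) (by rwa [h0])).congr_deriv ?_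
    rw [h0]
    rfl
  exact (hd.hasFDerivAt.hasLineDerivAt v).unique h1

/-- A primitive of the Fubini–Study form on `{z_i ≠ 0}`, in homogeneous coordinates: the form
`d^c log(|z|² / |z_i|²) / 4π`, where `d^c = i(∂̄ - ∂)`. -/
def primitiveForm {n : ℕ} (i : Fin (n + 1)) (z : Fin (n + 1) → ℂ) :
    (Fin (n + 1) → ℂ) →L[ℝ] ℝ :=
  (2 * Real.pi * normSqSum z)⁻¹ • Complex.imCLM.comp
      (∑ k, star (z k) • ContinuousLinearMap.proj (R := ℝ) (φ := fun _ : Fin (n + 1) => ℂ) k)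
    - (2 * Real.pi)⁻¹ • Complex.imCLM.comp
      ((z i)⁻¹ • ContinuousLinearMap.proj (R := ℝ) (φ := fun _ : Fin (n + 1) => ℂ) i)

theorem primitiveForm_apply {n : ℕ} (i : Fin (n + 1)) (z b : Fin (n + 1) → ℂ) :
    primitiveForm i z b = (herm z b).im / (2 * Real.pi * normSqSum z)
      - (b i / z i).im / (2 * Real.pi) := by
  simp [primitiveForm, herm, div_eq_inv_mul]

/-- `primitiveForm i` is basic for `ℂⁿ⁺¹ ∖ {0} → ℂPⁿ`, so it descends to `{z_i ≠ 0} ⊆ ℂPⁿ`. The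
`dz_i` term is closed and cancels the value of the other term on the fibres. -/
theorem primitiveForm_smul {n : ℕ} {i : Fin (n + 1)} {c : ℂ} (hc : c ≠ 0) (r : ℂ)
    {z : Fin (n + 1) → ℂ} (hi : z i ≠ 0) (b : Fin (n + 1) → ℂ) :
    primitiveForm i (c • z) (c • b + r • z) = primitiveForm i z b := by
  have hz : z ≠ 0 := fun h => hi (by rw [h]; rfl)
  have hN := (normSqSum_pos hz).ne'
  have hc' : (‖c‖ : ℝ) ^ 2 ≠ 0 := by simpa using hc
  have e : star c * c = ((‖c‖ ^ 2 : ℝ) : ℂ) := by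
    rw [Complex.star_def, Complex.conj_mul']; push_cast; rfl
  have e1 : herm (c • z) (c • b + r • z)
      = ((‖c‖ ^ 2 : ℝ) : ℂ) * (herm z b + (normSqSum z : ℂ) * (r / c)) := by
    rw [← e, herm_add_right, herm_smul_left, herm_smul_left, herm_smul_right, herm_smul_right,
      herm_self]
    field_simp
  have e2 : (c • b + r • z) i / (c • z) i = b i / z i + r / c := by
    simp only [Pi.add_apply, Pi.smul_apply, smul_eq_mul]
    field_simp
  rw [primitiveForm_apply, primitiveForm_apply, e1, e2, normSqSum_smul, Complex.im_ofReal_mul,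
    Complex.add_im, Complex.add_im, Complex.im_ofReal_mul]
  field_simp
  ring

theorem contDiffAt_primitiveForm {n : ℕ} {i : Fin (n + 1)} {z : Fin (n + 1) → ℂ} (hi : z i ≠ 0) :
    ContDiffAt ℝ ∞ (primitiveForm i) z := by
  have hz : z ≠ 0 := fun h => hi (by rw [h]; rfl)
  have hN := (normSqSum_pos hz).ne'
  have hs : ContDiff ℝ ∞ (star : ℂ → ℂ) := Complex.conjCLE.contDiff
  refine ContDiffAt.sub (ContDiffAt.fun_smul ?_ ?_) (ContDiffAt.fun_smul contDiffAt_const ?_)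
  · exact (contDiffAt_const.mul contDiff_normSqSum.contDiffAt).inv
      (mul_ne_zero (by positivity) hN)
  · refine contDiffAt_const.clm_comp (ContDiffAt.sum fun k _ =>
      ContDiffAt.fun_smul ?_ contDiffAt_const)
    exact (hs.comp (contDiff_apply ℝ ℂ k)).contDiffAt
  · exact contDiffAt_const.clm_comp
      (((contDiff_apply ℝ ℂ i).contDiffAt.inv hi).fun_smul contDiffAt_const)

theorem fderiv_primitiveForm {n : ℕ} {i : Fin (n + 1)} {z : Fin (n + 1) → ℂ} (hi : z i ≠ 0)
    (a b : Fin (n + 1) → ℂ) :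
    fderiv ℝ (primitiveForm i) z a b
      = (herm a b).im / (2 * Real.pi * normSqSum z)
        - (herm z a).re * (herm z b).im / (Real.pi * normSqSum z ^ 2)
        + (a i * b i / z i ^ 2).im / (2 * Real.pi) := by
  have hz : z ≠ 0 := fun h => hi (by rw [h]; rfl)
  have hN := (normSqSum_pos hz).ne'
  have hpi := Real.pi_ne_zero
  have h1 := (((contDiffAt_primitiveForm hi).differentiableAt
    (by simp)).hasFDerivAt.clm_apply (hasFDerivAt_const b z)).hasLineDerivAt a
  have hz0 : z + (0 : ℝ) • a = z := by simp
  have hi0 : (z + (0 : ℝ) • a) i = z i := by rw [hz0]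
  have hN0 := (hasFDerivAt_normSqSum z).hasLineDerivAt a
  rw [HasLineDerivAt, hasFDerivAt_normSqSum_apply] at hN0
  have hx : HasDerivAt (fun t : ℝ => (z + t • a) i) (a i) 0 := by
    simpa using ((hasDerivAt_id (0 : ℝ)).smul_const (a i)).const_add (z i)
  have hh : HasDerivAt (fun t : ℝ => herm (z + t • a) b) (herm a b) 0 := by
    have e (t : ℝ) : herm (z + t • a) b = herm z b + t • herm a b := by
      rw [herm_add_left, show t • a = (t : ℂ) • a from rfl, herm_smul_left]
      simp
    simp only [e]
    simpa using ((hasDerivAt_id (0 : ℝ)).smul_const (herm a b)).const_add (herm z b)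
  have him : HasDerivAt (fun t : ℝ => (herm (z + t • a) b).im) (herm a b).im 0 :=
    Complex.imCLM.hasFDerivAt.comp_hasDerivAt _ hh
  have hq : HasDerivAt (fun t : ℝ => (b i / (z + t • a) i).im) ((-(b i * a i) / z i ^ 2).im) 0 := by
    have := (hasDerivAt_const (0 : ℝ) (b i)).fun_div hx (by rwa [hi0])
    rw [hi0, zero_mul, zero_sub] at this
    exact Complex.imCLM.hasFDerivAt.comp_hasDerivAt _ this
  have h2 := (him.fun_div (hN0.const_mul (2 * Real.pi)) (by rw [hz0]; positivity)).fun_sub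
    (hq.div_const (2 * Real.pi))
  simp only [HasLineDerivAt, primitiveForm_apply] at h1
  have h3 := HasDerivAt.unique h1 h2
  simp only [hz0] at h3
  rw [_root_.add_apply, ContinuousLinearMap.comp_apply, _root_.zero_apply, map_zero, zero_add,
    ContinuousLinearMap.flip_apply] at h3
  rw [h3, neg_div, Complex.neg_im, mul_comm (b i)]
  field_simp
  ring

/-- `primitiveForm i` is a primitive of the lifted Fubini–Study form. -/
theorem fderiv_primitiveForm_sub {n : ℕ} {i : Fin (n + 1)} {z : Fin (n + 1) → ℂ} (hi : z i ≠ 0)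
    (a b : Fin (n + 1) → ℂ) :
    fderiv ℝ (primitiveForm i) z a b - fderiv ℝ (primitiveForm i) z b a = liftForm z a b := by
  have hz : z ≠ 0 := fun h => hi (by rw [h]; rfl)
  have hN := (normSqSum_pos hz).ne'
  have hpi := Real.pi_ne_zero
  have e1 : (herm b a).im = -(herm a b).im := by rw [← star_herm a b]; simp
  have e2 : herm a z = star (herm z a) := (star_herm z a).symm
  rw [fderiv_primitiveForm hi, fderiv_primitiveForm hi, liftForm, e1, e2, mul_comm (b i),
    Complex.sub_im, Complex.im_ofReal_mul, Complex.mul_im]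
  simp
  field_simp
  ring

theorem exactOn_chartDomain {n : ℕ} (i : Fin (n + 1)) : ExactOn (chartDomain (n := n) i) := by
  -- `lam` is the form on `ℂPⁿ` induced by `primitiveForm i`, read in the preferred charts; `key`
  -- says that its pullback to any affine chart is the pullback of `primitiveForm i` under
  -- `affineVec j`.
  let lam : (p : CP n) → TangentSpace 𝓘(ℝ, Cn n) p →L[ℝ] ℝ := fun p =>
    ((primitiveForm i (affineVec (chartIdx p) (affineCoord (chartIdx p) p))).comp
      (affineTangentL (chartIdx p)) : Cn n →L[ℝ] ℝ)
  have key : ∀ j : Fin (n + 1), EqOn (pullbackAffine lam j)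
      (fun w => (primitiveForm i (affineVec j w)).comp (affineTangentL j))
      (affinePoint j ⁻¹' chartDomain i) := by
    intro j w hw
    have hi : affineVec j w i ≠ 0 := (mk_mem_chartDomain i _ (affineVec_ne_zero j w)).1 hw
    ext v
    have h := mfderiv_affinePoint j w v
    set J := chartIdx (affinePoint j w) with hJdef
    have hJ : affineVec j w J ≠ 0 := chartIdx_mk_ne_zero (affineVec_ne_zero j w)
    change primitiveForm i (affineVec J (affineCoord J (affinePoint j w))) (affineTangent J
      ((mfderiv 𝓘(ℝ, Cn n) 𝓘(ℝ, Cn n) (affinePoint j) w : Cn n →L[ℝ] Cn n) v)) = _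
    rw [h, affineTangent_projDeriv hJ, affinePoint, affineVec_eq_smul _ hJ,
      primitiveForm_smul (inv_ne_zero hJ) _ hi]
    rfl
  have hopen : ∀ j : Fin (n + 1), IsOpen (affinePoint j ⁻¹' chartDomain (n := n) i) := fun j =>
    (isOpen_chartDomain i).preimage (continuous_affinePoint j)
  refine ⟨lam, fun j => ⟨?_, fun w hw u v => ?_⟩⟩
  · refine ContDiffOn.congr (fun w hw => ContDiffAt.contDiffWithinAt ?_) (key j)
    have hi : affineVec j w i ≠ 0 := (mk_mem_chartDomain i _ (affineVec_ne_zero j w)).1 hw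
    exact ((contDiffAt_primitiveForm hi).comp w (contDiff_affineVec j).contDiffAt).clm_comp
      contDiffAt_const
  · have hi : affineVec j w i ≠ 0 := (mk_mem_chartDomain i _ (affineVec_ne_zero j w)).1 hw
    have hd := (((contDiffAt_primitiveForm hi).differentiableAt
      (by simp)).hasFDerivAt.comp w (hasFDerivAt_affineVec j w))
    have hd2 := hd.clm_comp (hasFDerivAt_const (affineTangentL j) w)
    have e : fderiv ℝ (pullbackAffine lam j) w = _ :=
      (hd2.congr_of_eventuallyEq ((key j).eventuallyEq_of_mem ((hopen j).mem_nhds hw))).fderiv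
    rw [e, fubiniStudyAffine_eq_liftForm j, ← fderiv_primitiveForm_sub hi]
    simp

theorem ExactOn.mono {n : ℕ} {U V : Set (CP n)} (h : ExactOn V) (hUV : U ⊆ V) : ExactOn U := by
  obtain ⟨lam, hl⟩ := h
  exact ⟨lam, fun j => ⟨(hl j).1.mono (preimage_mono hUV), fun w hw => (hl j).2 w (hUV hw)⟩⟩

open MeasureTheory

/-! ### The volume form and its total mass -/

/-- The determinant of the imaginary part of a Hermitian form, as a real bilinear form, is the
square of the determinant of the Hermitian form. -/
theorem det_fromBlocks_im_re {n : ℕ} (A : Matrix (Fin n) (Fin n) ℂ) :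
    (((Matrix.fromBlocks (A.map Complex.im) (A.map Complex.re) (-A.map Complex.re)
      (A.map Complex.im)).det : ℝ) : ℂ) = A.det * star A.det := by
  set B : Matrix (Fin n) (Fin n) ℂ := A.map fun z => (z.im : ℂ) with hB
  set C : Matrix (Fin n) (Fin n) ℂ := A.map fun z => (z.re : ℂ) with hC
  have e : (((Matrix.fromBlocks (A.map Complex.im) (A.map Complex.re) (-A.map Complex.re)
      (A.map Complex.im)).det : ℝ) : ℂ) = (Matrix.fromBlocks B C (-C) B).det := by
    have h := RingHom.map_det Complex.ofRealHom (Matrix.fromBlocks (A.map Complex.im)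
      (A.map Complex.re) (-A.map Complex.re) (A.map Complex.im))
    rw [Complex.ofRealHom_eq_coe] at h
    rw [h]
    congr 1
    ext (a | a) (b | b) <;> simp [B, C]
  -- With `A = C + iB`, a row and a column operation make the matrix block triangular, with
  -- diagonal blocks `-iA` and `i` times the entrywise conjugate of `A`.
  have e1 : (Matrix.fromBlocks 1 0 (Complex.I • 1) 1 : Matrix (Fin n ⊕ Fin n) (Fin n ⊕ Fin n) ℂ)
      * Matrix.fromBlocks B C (-C) B * Matrix.fromBlocks 1 0 (-Complex.I • 1) 1
      = Matrix.fromBlocks (-Complex.I • A) C 0 (Complex.I • A.map star) := by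
    simp only [Matrix.fromBlocks_multiply]
    congr 1
    · ext a b
      apply Complex.ext <;> simp [B, C]
    · simp
    · ext a b
      apply Complex.ext <;> simp [B, C]
    · ext a b
      apply Complex.ext <;> simp [B, C]
  have e2 := congrArg Matrix.det e1
  rw [Matrix.det_mul, Matrix.det_mul, Matrix.det_fromBlocks_zero₁₂, Matrix.det_fromBlocks_zero₁₂,
    Matrix.det_fromBlocks_zero₂₁, Matrix.det_one, one_mul, one_mul, mul_one, Matrix.det_smul,
    Matrix.det_smul] at e2
  have e3 : (A.map star).det = star A.det := by
    rw [← Matrix.det_conjTranspose, ← Matrix.det_transpose]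
    rfl
  rw [e, e2, e3, mul_mul_mul_comm, ← mul_pow]
  simp

/-- The matrix `(1 + |w|²) - w w^*` of the Fubini–Study Hermitian form, up to scale. -/
def fubiniStudyMatrix {n : ℕ} (w : Cn n) : Matrix (Fin n) (Fin n) ℂ :=
  Matrix.of fun k l => ((1 + normSqSum w : ℝ) : ℂ) * (1 : Matrix (Fin n) (Fin n) ℂ) k l
    - w k * star (w l)

theorem det_fubiniStudyMatrix {n : ℕ} (w : Cn n) :
    (fubiniStudyMatrix w).det = (((1 + normSqSum w) ^ n / (1 + normSqSum w) : ℝ) : ℂ) := by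
  have hN : (1 + normSqSum w : ℝ) ≠ 0 := by have := normSqSum_nonneg w; positivity
  have hN' : ((1 + normSqSum w : ℝ) : ℂ) ≠ 0 := by exact_mod_cast hN
  -- A rank one perturbation of a scalar matrix: the matrix determinant lemma applies.
  have e : fubiniStudyMatrix w = ((1 + normSqSum w : ℝ) : ℂ) • (1
      + Matrix.replicateCol Unit (-((1 + normSqSum w : ℝ) : ℂ)⁻¹ • w)
        * Matrix.replicateRow Unit (star w)) := by
    ext k l
    simp only [fubiniStudyMatrix, Matrix.of_apply, Matrix.smul_apply, Matrix.add_apply,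
      Matrix.mul_apply, Matrix.replicateCol_apply, Matrix.replicateRow_apply, Finset.univ_unique,
      Finset.sum_const, Finset.card_singleton, one_smul, smul_eq_mul, Pi.smul_apply, Pi.star_apply]
    field_simp
    ring
  have e1 : star w ⬝ᵥ w = (normSqSum w : ℂ) := herm_self w
  rw [e, Matrix.det_smul, Matrix.det_one_add_replicateCol_mul_replicateRow, dotProduct_smul, e1,
    Fintype.card_fin]
  push_cast at hN' ⊢
  rw [smul_eq_mul]
  field_simp
  ring

/-- `ωⁿ` is `n! / (πⁿ (1 + |w|²)ⁿ⁺¹)` times Lebesgue measure. -/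
theorem volumeDensity_eq {n : ℕ} (w : Cn n) :
    volumeDensity w = n.factorial / Real.pi ^ n / (1 + normSqSum w) ^ (n + 1) := by
  have hN : (0 : ℝ) < 1 + normSqSum w := by have := normSqSum_nonneg w; positivity
  have hpi := Real.pi_pos
  have e : (Matrix.of fun a b : Fin n ⊕ Fin n =>
      fubiniStudyAffine w (realBasisVec a) (realBasisVec b))
      = (Real.pi * (1 + normSqSum w) ^ 2)⁻¹ • Matrix.fromBlocks
        ((fubiniStudyMatrix w).map Complex.im) ((fubiniStudyMatrix w).map Complex.re)
        (-(fubiniStudyMatrix w).map Complex.re) ((fubiniStudyMatrix w).map Complex.im) := by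
    have key (u v : Cn n) : fubiniStudyAffine w u v = (Real.pi * (1 + normSqSum w) ^ 2)⁻¹ *
        (((1 + normSqSum w : ℝ) : ℂ) * herm u v - herm u w * herm w v).im := by
      rw [Complex.sub_im, Complex.im_ofReal_mul, ← div_eq_inv_mul]
      rfl
    have h1 (k : Fin n) (c : ℂ) (v : Cn n) : herm (Pi.single k c) v = star c * v k := by
      rw [herm, Finset.sum_eq_single k]
      · simp
      · intro l _ hl
        simp [hl]
      · simp
    have h2 (k : Fin n) (c : ℂ) (v : Cn n) : herm v (Pi.single k c) = star (v k) * c := by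
      rw [← star_herm, h1]
      simp [mul_comm]
    ext (a | a) (b | b) <;>
    · rw [Matrix.of_apply, key, Matrix.smul_apply, smul_eq_mul]
      congr 1
      simp [realBasisVec, h1, h2, fubiniStudyMatrix, Matrix.one_apply, Pi.single_apply]
      try split_ifs <;> simp <;> ring
  have hdet : (Matrix.fromBlocks
        ((fubiniStudyMatrix w).map Complex.im) ((fubiniStudyMatrix w).map Complex.re)
        (-(fubiniStudyMatrix w).map Complex.re) ((fubiniStudyMatrix w).map Complex.im)).det
      = ((1 + normSqSum w) ^ n / (1 + normSqSum w)) ^ 2 := by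
    have h := det_fromBlocks_im_re (fubiniStudyMatrix w)
    rw [det_fubiniStudyMatrix, Complex.star_def, Complex.conj_ofReal, ← Complex.ofReal_mul,
      Complex.ofReal_inj] at h
    rw [h, sq]
  have hsq : ((Real.pi * (1 + normSqSum w) ^ 2)⁻¹) ^ (n + n) *
      ((1 + normSqSum w) ^ n / (1 + normSqSum w)) ^ 2
      = (1 / Real.pi ^ n / (1 + normSqSum w) ^ (n + 1)) ^ 2 := by
    rw [inv_pow, mul_pow, ← pow_mul]
    field_simp
    ring
  rw [volumeDensity, e, Matrix.det_smul, hdet, Fintype.card_sum, Fintype.card_fin, hsq,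
    Real.sqrt_sq (by positivity)]
  ring

theorem integral_exp_neg_mul_normSqSum {n : ℕ} {t : ℝ} (ht : 0 < t) :
    ∫ w : Cn n, Real.exp (-t * normSqSum w) = (Real.pi / t) ^ n := by
  have e (w : Cn n) : Real.exp (-t * normSqSum w) = ∏ k, Real.exp (-t * ‖w k‖ ^ 2) := by
    rw [← Real.exp_sum, normSqSum, Finset.mul_sum]
  simp only [e]
  rw [integral_fintype_prod_volume_eq_pow (fun z : ℂ => Real.exp (-t * ‖z‖ ^ 2)),
    GaussianFourier.integral_rexp_neg_mul_sq_norm ht, Complex.finrank_real_complex,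
    Fintype.card_fin]
  norm_num

theorem integral_pow_mul_exp_neg_mul {n : ℕ} {r : ℝ} (hr : 0 < r) :
    ∫ t in Ioi (0 : ℝ), t ^ n * Real.exp (-(t * r)) = n.factorial / r ^ (n + 1) := by
  have h := Real.integral_rpow_mul_exp_neg_mul_Ioi (a := n + 1) (by positivity) hr
  rw [Real.Gamma_nat_eq_factorial, add_sub_cancel_right] at h
  simp only [Real.rpow_natCast] at h
  simp only [mul_comm _ r]
  rw [h, ← Nat.cast_add_one, Real.rpow_natCast, one_div, inv_pow]
  ring

/-- `t^n exp(-t (1 + |w|²))` is integrable in `(w, t)`; integrating out `t` or `w` first compares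
`∫ (1 + |w|²)^{-(n + 1)} dw` with Gaussian integrals. -/
theorem integrable_pow_mul_exp (n : ℕ) :
    Integrable (Function.uncurry fun (w : Cn n) (t : ℝ) =>
      t ^ n * Real.exp (-(t * (1 + normSqSum w))))
      ((volume : Measure (Cn n)).prod (volume.restrict (Ioi (0 : ℝ)))) := by
  have hmeas : AEStronglyMeasurable (Function.uncurry fun (w : Cn n) (t : ℝ) =>
      t ^ n * Real.exp (-(t * (1 + normSqSum w))))
      ((volume : Measure (Cn n)).prod (volume.restrict (Ioi (0 : ℝ)))) := by
    refine Continuous.aestronglyMeasurable ?_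
    have := (continuous_normSqSum (ι := Fin n)).comp (continuous_fst (X := Cn n) (Y := ℝ))
    simp only [Function.uncurry_def]
    refine (continuous_snd.pow n).mul (Real.continuous_exp.comp ?_)
    exact (continuous_snd.mul (continuous_const.add this)).neg
  have e (w : Cn n) (t : ℝ) : t ^ n * Real.exp (-(t * (1 + normSqSum w)))
      = t ^ n * Real.exp (-t) * Real.exp (-t * normSqSum w) := by
    rw [mul_assoc, ← Real.exp_add]
    ring_nf
  rw [integrable_prod_iff' hmeas]
  constructor
  · refine (ae_restrict_iff' measurableSet_Ioi).2 (Filter.Eventually.of_forall fun t ht => ?_)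
    simp only [Function.uncurry_apply_pair, e]
    refine Integrable.const_mul (Integrable.of_integral_ne_zero ?_) _
    rw [integral_exp_neg_mul_normSqSum ht]
    have : 0 < t := ht
    positivity
  · refine IntegrableOn.congr_fun (f := fun t => Real.pi ^ n * Real.exp (-t))
      ((integrableOn_exp_neg_Ioi 0).const_mul _) (fun t ht => ?_) measurableSet_Ioi
    have ht' : 0 < t := ht
    have e2 (w : Cn n) : ‖t ^ n * Real.exp (-(t * (1 + normSqSum w)))‖
        = t ^ n * Real.exp (-t) * Real.exp (-t * normSqSum w) := by
      rw [Real.norm_of_nonneg (by positivity), e]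
    simp only [Function.uncurry_apply_pair, e2]
    rw [integral_const_mul, integral_exp_neg_mul_normSqSum ht, div_pow]
    field_simp

/-- The total mass of `ωⁿ` is `1`. -/
theorem integral_volumeDensity (n : ℕ) : ∫ w : Cn n, volumeDensity w = 1 := by
  have hpi := Real.pi_pos
  have h := integral_integral_swap (integrable_pow_mul_exp n)
  have h1 (w : Cn n) : ∫ t in Ioi (0 : ℝ), t ^ n * Real.exp (-(t * (1 + normSqSum w)))
      = Real.pi ^ n * volumeDensity w := by
    have := normSqSum_nonneg w
    rw [integral_pow_mul_exp_neg_mul (by positivity), volumeDensity_eq]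
    field_simp
  have h2 : ∫ t in Ioi (0 : ℝ), ∫ w : Cn n, t ^ n * Real.exp (-(t * (1 + normSqSum w)))
      = ∫ t in Ioi (0 : ℝ), Real.pi ^ n * Real.exp (-t) := by
    refine setIntegral_congr_fun measurableSet_Ioi fun t ht => ?_
    have ht' : 0 < t := ht
    have e (w : Cn n) : t ^ n * Real.exp (-(t * (1 + normSqSum w)))
        = t ^ n * Real.exp (-t) * Real.exp (-t * normSqSum w) := by
      rw [mul_assoc, ← Real.exp_add]
      ring_nf
    simp only [e]
    rw [integral_const_mul, integral_exp_neg_mul_normSqSum ht, div_pow]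
    field_simp
  simp only [h1] at h
  rw [h2, integral_const_mul, integral_const_mul, integral_exp_neg_Ioi_zero, mul_one] at h
  exact (mul_eq_left₀ (by positivity)).1 h

theorem integrable_volumeDensity (n : ℕ) : Integrable (volumeDensity (n := n)) :=
  Integrable.of_integral_ne_zero (by rw [integral_volumeDensity]; exact one_ne_zero)

theorem volumeDensity_nonneg {n : ℕ} (w : Cn n) : 0 ≤ volumeDensity w := by
  unfold volumeDensity
  positivity

theorem isCompact_momentSimplex (n : ℕ) : IsCompact (momentSimplex n) := by
  refine (isCompact_Icc (a := (0 : Fin n → ℝ)) (b := 1)).of_isClosed_subset ?_ ?_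
  · exact IsClosed.inter (isClosed_Ici (a := (0 : Fin n → ℝ)))
      (isClosed_le (by fun_prop : Continuous fun p : Fin n → ℝ => ∑ i, p i) continuous_const)
  · rintro p ⟨h1, h2⟩
    exact ⟨h1, fun i => (Finset.single_le_sum (fun i _ => h1 i) (Finset.mem_univ i)).trans h2⟩

theorem integrable_integralVolume {n : ℕ} {G : (Fin n → ℝ) → ℝ} (hG : Continuous G) :
    Integrable fun w : Cn n => G (momentMap (affinePoint 0 w)) * volumeDensity w := by
  obtain ⟨c, hc⟩ := (isCompact_momentSimplex n).exists_bound_of_continuousOn hG.continuousOn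
  exact (integrable_volumeDensity n).bdd_mul
    (hG.comp (continuous_momentMap.comp (continuous_affinePoint 0))).aestronglyMeasurable
    (Filter.Eventually.of_forall fun w => hc _ (momentMap_mem _))

theorem integralVolume_add {n : ℕ} {F G : (Fin n → ℝ) → ℝ} (hF : Continuous F)
    (hG : Continuous G) : integralVolume (fun p : CP n => (F + G) (momentMap p))
      = integralVolume (fun p : CP n => F (momentMap p))
        + integralVolume (fun p : CP n => G (momentMap p)) := by
  rw [integralVolume, integralVolume, integralVolume,
    ← integral_add (integrable_integralVolume hF) (integrable_integralVolume hG)]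
  simp only [Pi.add_apply, add_mul]

theorem integralVolume_const {n : ℕ} (c : ℝ) : integralVolume (fun _ : CP n => c) = c := by
  rw [integralVolume, integral_const_mul, integral_volumeDensity, mul_one]

theorem abs_integralVolume_le {n : ℕ} {F : CP n → ℝ} {c : ℝ} (hF : ∀ p, |F p| ≤ c) :
    |integralVolume F| ≤ c := by
  have h := norm_integral_le_of_norm_le ((integrable_volumeDensity n).const_mul c)
    (f := fun w : Cn n => F (affinePoint 0 w) * volumeDensity w)
    (Filter.Eventually.of_forall fun w => by
      rw [norm_mul, Real.norm_eq_abs, Real.norm_of_nonneg (volumeDensity_nonneg w)]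
      exact mul_le_mul_of_nonneg_right (hF _) (volumeDensity_nonneg w))
  rwa [integral_const_mul, integral_volumeDensity, mul_one] at h

/-! ### Homogeneous quasimorphisms and the Hofer norm -/

/-- A homogeneous quasimorphism is additive on commuting elements. -/
theorem IsQuasimorphism.map_mul_of_commute {G : Type*} [Group G] {μ : G → ℝ}
    (hμ : IsQuasimorphism μ) (hh : IsHomogeneous μ) {f g : G} (hfg : Commute f g) :
    μ (f * g) = μ f + μ g := by
  obtain ⟨R, hR, h⟩ := hμ
  -- The defect of the pair `(fᵐ, gᵐ)` is `m` times that of `(f, g)`, but also at most `R`.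
  have key (m : ℕ) : m * |μ (f * g) - μ f - μ g| ≤ R := by
    have := h (f ^ (m : ℤ)) (g ^ (m : ℤ))
    rw [← hfg.mul_zpow, hh, hh, hh, ← mul_sub, ← mul_sub, abs_mul] at this
    simpa using this
  by_contra hne
  have hpos : 0 < |μ (f * g) - μ f - μ g| := abs_pos.2 fun h0 => hne (by linarith)
  obtain ⟨m, hm⟩ := exists_nat_gt (R / |μ (f * g) - μ f - μ g|)
  rw [div_lt_iff₀ hpos] at hm
  exact absurd (key m) (not_le.2 hm)

theorem IsHomogeneous.map_one {G : Type*} [Group G] {μ : G → ℝ} (hh : IsHomogeneous μ) :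
    μ 1 = 0 := by
  simpa using hh 1 0

theorem compactSpace_CP (n : ℕ) : CompactSpace (CP n) := by
  have hc : CompactSpace (Metric.sphere (0 : Fin (n + 1) → ℂ) 1) :=
    isCompact_iff_compactSpace.1 (isCompact_sphere _ _)
  have hne (v : Metric.sphere (0 : Fin (n + 1) → ℂ) 1) : v.1 ≠ 0 :=
    ne_zero_of_mem_unit_sphere v
  have hcont : Continuous fun v : Metric.sphere (0 : Fin (n + 1) → ℂ) 1 =>
      Projectivization.mk ℂ v.1 (hne v) :=
    (isQuotientMap_mk n).continuous.comp (continuous_subtype_val.subtype_mk hne)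
  refine Function.Surjective.compactSpace hcont fun p => ?_
  have hp : ‖p.rep‖ ≠ 0 := norm_ne_zero_iff.2 p.rep_nonzero
  refine ⟨⟨((‖p.rep‖⁻¹ : ℝ) : ℂ) • p.rep, by simp [norm_smul, hp]⟩, ?_⟩
  conv_rhs => rw [← p.mk_rep]
  exact (Projectivization.mk_eq_mk_iff' _ _ _ _ _).2 ⟨_, rfl⟩

/-- The lengths of all Hamiltonians are nonnegative, by compactness of `ℂPⁿ`, so the infimum
defining the Hofer norm is a lower bound. -/
theorem hoferNorm_le {n : ℕ} {H : ℝ → CP n → ℝ} {g : Ham n} (hg : IsTimeOneMap H g) :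
    hoferNorm g ≤ ∫ t in (0 : ℝ)..1, ((⨆ x, H t x) - ⨅ x, H t x) := by
  refine csInf_le ⟨0, ?_⟩ ⟨H, hg, rfl⟩
  rintro _ ⟨K, hK, rfl⟩
  refine intervalIntegral.integral_nonneg zero_le_one fun t ht => ?_
  have := compactSpace_CP n
  have hcont : Continuous (K t) := continuous_iff_continuousAt.2 fun p =>
    (hK.1.mdifferentiableAt ht p).continuousAt
  have hne : Nonempty (CP n) := ⟨affinePoint 0 0⟩
  have x : CP n := hne.some
  exact sub_nonneg.2 ((ciInf_le (isCompact_range hcont).bddBelow x).trans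
    (le_ciSup (isCompact_range hcont).bddAbove x))

theorem hoferDist_one_torusHam_le {n : ℕ} {G : (Fin n → ℝ) → ℝ} (hG : ContDiff ℝ ∞ G) {c : ℝ}
    (hc : ∀ x ∈ momentSimplex n, |G x| ≤ c) : hoferDist 1 (torusHam G hG) ≤ 2 * c := by
  have hne : Nonempty (CP n) := ⟨affinePoint 0 0⟩
  have h := hoferNorm_le (g := torusHam G hG) (isTimeOneMap_torusPerm hG)
  rw [intervalIntegral.integral_const, sub_zero, one_smul] at h
  rw [hoferDist, inv_one, one_mul]
  have h1 : ⨆ x : CP n, G (momentMap x) ≤ c :=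
    ciSup_le fun x => (abs_le.1 (hc _ (momentMap_mem x))).2
  have h2 : -c ≤ ⨅ x : CP n, G (momentMap x) :=
    le_ciInf fun x => (abs_le.1 (hc _ (momentMap_mem x))).1
  linarith

/-! ### The Calabi defect on torus-invariant Hamiltonians -/

/-- The difference between a function `μ` on `Ham(ℂPⁿ)` and the Calabi invariant, on the time-one
map of `G ∘ Φ`. -/
def calabiDefect {n : ℕ} (μ : Ham n → ℝ) (G : (Fin n → ℝ) → ℝ) (hG : ContDiff ℝ ∞ G) : ℝ :=
  μ (torusHam G hG) - integralVolume fun p : CP n => G (momentMap p)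

section defect

variable {n : ℕ} {μ : Ham n → ℝ}

theorem calabiDefect_congr {F G : (Fin n → ℝ) → ℝ} (h : F = G) (hF : ContDiff ℝ ∞ F)
    (hG : ContDiff ℝ ∞ G) : calabiDefect μ F hF = calabiDefect μ G hG := by
  subst h
  rfl

theorem calabiDefect_add (hC : IsCalabiQuasimorphism μ) (hh : IsHomogeneous μ)
    {F G : (Fin n → ℝ) → ℝ} (hF : ContDiff ℝ ∞ F) (hG : ContDiff ℝ ∞ G) :
    calabiDefect μ (F + G) (hF.add hG) = calabiDefect μ F hF + calabiDefect μ G hG := by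
  rw [calabiDefect, torusHam_add hF hG,
    hC.quasimorphism.map_mul_of_commute hh (commute_torusHam hF hG),
    integralVolume_add hF.continuous hG.continuous, calabiDefect, calabiDefect]
  ring

theorem calabiDefect_const (hh : IsHomogeneous μ) (c : ℝ) :
    calabiDefect μ (fun _ : Fin n → ℝ => c) contDiff_const = -c := by
  rw [calabiDefect, torusHam_const, hh.map_one, integralVolume_const, zero_sub]

/-- Hofer continuity makes the defect continuous in the uniform norm. -/
theorem exists_abs_calabiDefect_lt (hh : IsHomogeneous μ) (hH : HoferContinuous μ) {η : ℝ}
    (hη : 0 < η) : ∃ δ > 0, ∀ (G : (Fin n → ℝ) → ℝ) (hG : ContDiff ℝ ∞ G),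
      (∀ x ∈ momentSimplex n, |G x| ≤ δ) → |calabiDefect μ G hG| < η := by
  obtain ⟨δ, hδ, h⟩ := hH 1 (η / 2) (by positivity)
  refine ⟨min (δ / 3) (η / 2), by positivity, fun G hG hb => ?_⟩
  have h1 := hoferDist_one_torusHam_le hG hb
  have h2 := h (torusHam G hG) (h1.trans_lt (by linarith [min_le_left (δ / 3) (η / 2)]))
  rw [hh.map_one, sub_zero] at h2
  have h3 := abs_integralVolume_le (F := fun p : CP n => G (momentMap p))
    fun p => hb _ (momentMap_mem p)
  have h4 := min_le_right (δ / 3) (η / 2)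
  rw [calabiDefect]
  exact (abs_sub _ _).trans_lt (by linarith)

/-- The Calabi property, applied to `{|z_j| < |z_i|}`. -/
theorem calabiDefect_eq_zero (hC : IsCalabiQuasimorphism μ) {G : (Fin n → ℝ) → ℝ}
    (hG : ContDiff ℝ ∞ G) {i j : Fin (n + 1)} (hij : i ≠ j) {ε : ℝ} (hε : 0 < ε)
    (h : ∀ p : CP n, baryCoord i p - baryCoord j p < ε → G (momentMap p) = 0) :
    calabiDefect μ G hG = 0 := by
  have hs : tsupport (fun p : CP n => G (momentMap p)) ⊆ dominated i j := by
    have h1 : tsupport (fun p : CP n => G (momentMap p))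
        ⊆ {p | ε ≤ baryCoord i p - baryCoord j p} := by
      refine closure_minimal (fun p hp => ?_) (isClosed_le continuous_const
        ((continuous_baryCoord i).sub (continuous_baryCoord j)))
      by_contra hlt
      exact hp (h p (not_le.1 hlt))
    exact h1.trans fun p (hp : ε ≤ _) => show baryCoord j p < baryCoord i p by linarith
  have := hC.calabi _ (isOpen_dominated i j) (dominated_nonempty hij) (displaceable_dominated hij)
    ((exactOn_chartDomain i).mono (dominated_subset_chartDomain i j)) _ (torusHam G hG)
    (isTimeOneMap_torusPerm hG) fun _ _ => hs
  rw [intervalIntegral.integral_const, sub_zero, one_smul] at this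
  rw [calabiDefect, this, sub_self]

end defect

/-! ### Localization at the barycenter -/

/-- The barycentric coordinates on `ℝⁿ ⊇ Δ`. -/
def bary {n : ℕ} (i : Fin (n + 1)) (x : Fin n → ℝ) : ℝ :=
  Fin.cases (motive := fun _ => ℝ) (1 - ∑ k, x k) x i

theorem sum_bary {n : ℕ} (x : Fin n → ℝ) : ∑ i, bary i x = 1 := by
  simp [Fin.sum_univ_succ, bary]

theorem sum_baryCoord {n : ℕ} (p : CP n) : ∑ i, baryCoord i p = 1 := by
  simp only [baryCoord, ← Finset.sum_div]
  exact div_self (normSqSum_pos p.rep_nonzero).ne'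

theorem bary_momentMap {n : ℕ} (i : Fin (n + 1)) (p : CP n) :
    bary i (momentMap p) = baryCoord i p := by
  refine Fin.cases ?_ (fun k => rfl) i
  have := sum_baryCoord p
  rw [Fin.sum_univ_succ] at this
  simp only [bary, Fin.cases_zero, momentMap_apply]
  linarith

theorem contDiff_bary {n : ℕ} (i : Fin (n + 1)) : ContDiff ℝ ∞ (bary (n := n) i) := by
  refine Fin.cases ?_ (fun k => ?_) i
  · exact contDiff_const.sub (ContDiff.sum fun k _ => contDiff_apply ℝ ℝ k)
  · exact contDiff_apply ℝ ℝ k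

/-- A smooth function which vanishes where `x_i - x_j ≤ ε`, and is `1` where `x_i - x_j ≥ 2ε`. -/
def cutoff {n : ℕ} (ε : ℝ) (i j : Fin (n + 1)) (x : Fin n → ℝ) : ℝ :=
  Real.smoothTransition ((bary i x - bary j x) / ε - 1)

theorem contDiff_cutoff {n : ℕ} (ε : ℝ) (i j : Fin (n + 1)) :
    ContDiff ℝ ∞ (cutoff (n := n) ε i j) :=
  Real.smoothTransition.contDiff.comp
    ((((contDiff_bary i).sub (contDiff_bary j)).div_const ε).sub contDiff_const)

/-- The product of the functions `1 - cutoff ε i j` over the pairs `(i, j)` in `s`. For the set of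
all pairs, it is supported near the barycenter. -/
def coreCutoff {n : ℕ} (ε : ℝ) (s : Finset (Fin (n + 1) × Fin (n + 1))) (x : Fin n → ℝ) : ℝ :=
  ∏ q ∈ s, (1 - cutoff ε q.1 q.2 x)

theorem contDiff_coreCutoff {n : ℕ} (ε : ℝ) (s : Finset (Fin (n + 1) × Fin (n + 1))) :
    ContDiff ℝ ∞ (coreCutoff (n := n) ε s) :=
  contDiff_prod fun q _ => contDiff_const.sub (contDiff_cutoff ε q.1 q.2)

theorem abs_coreCutoff_le_one {n : ℕ} (ε : ℝ) (s : Finset (Fin (n + 1) × Fin (n + 1)))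
    (x : Fin n → ℝ) : |coreCutoff ε s x| ≤ 1 := by
  rw [coreCutoff, Finset.abs_prod]
  refine Finset.prod_le_one (fun _ _ => abs_nonneg _) fun q _ => ?_
  have h1 := Real.smoothTransition.nonneg ((bary q.1 x - bary q.2 x) / ε - 1)
  have h2 := Real.smoothTransition.le_one ((bary q.1 x - bary q.2 x) / ε - 1)
  rw [abs_le, cutoff]
  constructor <;> linarith

/-- The support of `coreCutoff ε` is near the barycenter: there, all differences of barycentric
coordinates are less than `2ε`, while the average of the coordinates is `1 / (n + 1)`. -/
theorem dist_clifPoint_le {n : ℕ} {ε : ℝ} (hε : 0 < ε) {x : Fin n → ℝ}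
    (h : coreCutoff ε Finset.univ x ≠ 0) : dist x (clifPoint n) ≤ 2 * ε := by
  have h1 (i j : Fin (n + 1)) : bary i x - bary j x < 2 * ε := by
    by_contra hlt
    refine h (Finset.prod_eq_zero (Finset.mem_univ (i, j)) ?_)
    have h2 : 1 ≤ (bary i x - bary j x) / ε - 1 := by
      rw [le_sub_iff_add_le, le_div_iff₀ hε]
      linarith [not_lt.1 hlt]
    rw [cutoff, Real.smoothTransition.one_of_one_le h2, sub_self]
  refine (dist_pi_le_iff (by positivity)).2 fun k => ?_
  have hn : (0 : ℝ) < n + 1 := by positivity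
  have hx : x k = bary k.succ x := rfl
  -- Summing over `j` compares `x_k` with the average of the barycentric coordinates.
  have h3 : ∑ j, (bary k.succ x - bary j x) = (n + 1) * x k - 1 := by
    rw [Finset.sum_sub_distrib, sum_bary, hx]
    simp
  have h4 : ∑ j, (bary k.succ x - bary j x) ≤ ∑ _j : Fin (n + 1), 2 * ε :=
    Finset.sum_le_sum fun j _ => (h1 _ _).le
  have h5 : ∑ _j : Fin (n + 1), -(2 * ε) ≤ ∑ j, (bary k.succ x - bary j x) :=
    Finset.sum_le_sum fun j _ => by linarith [h1 j k.succ]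
  rw [h3] at h4 h5
  simp only [Finset.sum_const, Finset.card_univ, Fintype.card_fin, nsmul_eq_mul] at h4 h5
  push_cast at h4 h5
  have e : x k - clifPoint n k = ((n + 1) * x k - 1) / (n + 1) := by
    rw [clifPoint]
    field_simp
  rw [Real.dist_eq, e, abs_le, le_div_iff₀ hn, div_le_iff₀ hn]
  constructor <;> linarith

section localization

variable {n : ℕ} {μ : Ham n → ℝ}

/-- Cutting off `G` away from the barycenter does not change the defect. -/
theorem calabiDefect_mul_coreCutoff (hC : IsCalabiQuasimorphism μ) (hh : IsHomogeneous μ)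
    {G : (Fin n → ℝ) → ℝ} (hG : ContDiff ℝ ∞ G) {ε : ℝ} (hε : 0 < ε)
    (s : Finset (Fin (n + 1) × Fin (n + 1))) :
    calabiDefect μ (G * coreCutoff ε s) (hG.mul (contDiff_coreCutoff ε s))
      = calabiDefect μ G hG := by
  induction s using Finset.induction_on with
  | empty =>
    congr 1
    ext x
    simp [coreCutoff]
  | insert q s hq ih =>
    rw [← ih]
    have hs : ContDiff ℝ ∞ (G * coreCutoff ε s) := hG.mul (contDiff_coreCutoff ε s)
    have h1 := calabiDefect_add hC hh (F := G * coreCutoff ε s * cutoff ε q.1 q.2)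
      (G := G * coreCutoff ε (insert q s)) (hs.mul (contDiff_cutoff ε q.1 q.2))
      (hG.mul (contDiff_coreCutoff ε (insert q s)))
    have e : G * coreCutoff ε s * cutoff ε q.1 q.2 + G * coreCutoff ε (insert q s)
        = G * coreCutoff ε s := by
      ext x
      simp only [Pi.add_apply, Pi.mul_apply, coreCutoff, Finset.prod_insert hq]
      ring
    have h2 : calabiDefect μ (G * coreCutoff ε s * cutoff ε q.1 q.2)
        (hs.mul (contDiff_cutoff ε q.1 q.2)) = 0 := by
      have hvan (x : Fin n → ℝ) (hx : bary q.1 x - bary q.2 x < ε) : cutoff ε q.1 q.2 x = 0 := by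
        refine Real.smoothTransition.zero_of_nonpos ?_
        rw [sub_nonpos, div_le_one hε]
        exact hx.le
      -- On the diagonal the cutoff function vanishes identically.
      by_cases hne : q.1 = q.2
      · have e0 : G * coreCutoff ε s * cutoff ε q.1 q.2 = fun _ => 0 := by
          ext x
          rw [Pi.mul_apply, hvan x (by rw [hne, sub_self]; exact hε), mul_zero]
        rw [calabiDefect_congr e0 _ contDiff_const, calabiDefect_const hh, neg_zero]
      · refine calabiDefect_eq_zero hC _ hne hε fun p hp => ?_
        rw [Pi.mul_apply, hvan _ (by rwa [bary_momentMap, bary_momentMap]), mul_zero]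
    rw [calabiDefect_congr e _ hs, h2, zero_add] at h1
    exact h1.symm

theorem calabiDefect_eq_zero_of_clifPoint (hC : IsCalabiQuasimorphism μ) (hh : IsHomogeneous μ)
    (hH : HoferContinuous μ) {G : (Fin n → ℝ) → ℝ} (hG : ContDiff ℝ ∞ G)
    (h0 : G (clifPoint n) = 0) : calabiDefect μ G hG = 0 := by
  by_contra hne
  obtain ⟨δ, hδ, h⟩ := exists_abs_calabiDefect_lt hh hH (abs_pos.2 hne)
  obtain ⟨r, hr, hGr⟩ := Metric.continuous_iff.1 hG.continuous (clifPoint n) δ hδ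
  have hε : 0 < r / 4 := by positivity
  refine lt_irrefl |calabiDefect μ G hG| ?_
  conv_lhs => rw [← calabiDefect_mul_coreCutoff hC hh hG hε Finset.univ]
  refine h _ _ fun x _ => ?_
  by_cases hx : coreCutoff (r / 4) Finset.univ x = 0
  · rw [Pi.mul_apply, hx, mul_zero, abs_zero]
    exact hδ.le
  · have h1 := hGr x (by linarith [dist_clifPoint_le hε hx])
    rw [h0, Real.dist_eq, sub_zero] at h1
    rw [Pi.mul_apply, abs_mul]
    exact (mul_le_of_le_one_right (abs_nonneg _) (abs_coreCutoff_le_one _ _ _)).trans h1.le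

/-- The defect is minus the evaluation at the barycenter. -/
theorem calabiDefect_eq (hC : IsCalabiQuasimorphism μ) (hh : IsHomogeneous μ)
    (hH : HoferContinuous μ) {G : (Fin n → ℝ) → ℝ} (hG : ContDiff ℝ ∞ G) :
    calabiDefect μ G hG = -G (clifPoint n) := by
  have hc : ContDiff ℝ ∞ fun _ : Fin n → ℝ => G (clifPoint n) := contDiff_const
  have h := calabiDefect_add hC hh (hG.sub hc) hc
  rw [calabiDefect_const hh, calabiDefect_eq_zero_of_clifPoint hC hh hH (hG.sub hc) (sub_self _),
    zero_add] at h
  rw [← h]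
  congr 1
  ext x
  simp

end localization

/-- A smooth function on the moment simplex extends to a smooth function on `ℝⁿ`. -/
theorem SmoothOnSimplex.exists_contDiff {n : ℕ} {Fbar : momentSimplex n → ℝ}
    (hF : SmoothOnSimplex Fbar) :
    ∃ G : (Fin n → ℝ) → ℝ, ContDiff ℝ ∞ G ∧ ∀ p : momentSimplex n, G p = Fbar p := by
  obtain ⟨V, hV, hsub, G, hG, hGF⟩ := hF
  obtain ⟨f, hf0, hf1, -⟩ := exists_contMDiffMap_zero_one_nhds_of_isClosed
    𝓘(ℝ, Fin n → ℝ) (n := ⊤) hV.isClosed_compl (isCompact_momentSimplex n).isClosed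
    (disjoint_compl_left_iff_subset.2 hsub)
  refine ⟨fun x => f x * G x, contDiff_iff_contDiffAt.2 fun x => ?_, fun p => ?_⟩
  · by_cases hx : x ∈ V
    · exact f.contMDiff.contDiff.contDiffAt.mul (hG.contDiffAt (hV.mem_nhds hx))
    · refine (contDiffAt_const (c := (0 : ℝ))).congr_of_eventuallyEq ?_
      filter_upwards [Filter.Eventually.filter_mono (nhds_le_nhdsSet hx) hf0] with y hy
      rw [hy, zero_mul]
  · have : f p = 1 := (Filter.Eventually.filter_mono (nhds_le_nhdsSet p.2) hf1).self_of_nhds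
    simp only [this, one_mul, hGF]

end CliffordCalabi

end

theorem mainTheorem4 (n : ℕ) (μ : Ham n → ℝ)
    (hCalabi : IsCalabiQuasimorphism μ) (hHomogeneous : IsHomogeneous μ)
    (hHofer : HoferContinuous μ)
    (Fbar : momentSimplex n → ℝ) (hFbar : SmoothOnSimplex Fbar) :
    (∃ φF : Ham n, IsTimeOneMap (fun _ => momentPullback Fbar) φF) ∧
    ∀ φF : Ham n, IsTimeOneMap (fun _ => momentPullback Fbar) φF →
      μ φF = integralVolume (momentPullback Fbar) - Fbar ⟨clifPoint n, clifPoint_mem n⟩ := by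
  obtain ⟨G, hG, hGF⟩ := hFbar.exists_contDiff
  have e : momentPullback Fbar = fun p => G (momentMap p) :=
    funext fun p => (hGF ⟨momentMap p, momentMap_mem p⟩).symm
  rw [e, ← hGF]
  refine ⟨⟨torusHam G hG, isTimeOneMap_torusPerm hG⟩, fun φF hφF => ?_⟩
  have h := calabiDefect_eq hCalabi hHomogeneous hHofer hG
  rw [calabiDefect] at h
  rw [hφF.eq_torusHam hG]
  linarith
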